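/- Let $n\ge 0$ and let $(W,S)$ be the Coxeter group of type $A_n$: $W=\mathcal S_{n+1}$, $S=\{s_1,\dots,s_n\}$ with $s_i=(i\ \,i{+}1)$, and $\ell(w)$ the number of inversions of $w$. *Definitions.* For $I\subset S$ let $W_I$ be the subgroup generated by $I$, $w_I$ its longest element, $\ell(I)=\ell(w_I)$. For $I,J\subset S$, an $(I,J)$-coset is a double coset $p\in W_I\backslash W/W_J$, with maximal element $\overline p$ and minimal element $\underline p$. Its left and right redundancies are $I\cap \underline pJ\underline p^{-1}$ and $\underline p^{-1}I\underline p\cap J$; $p$ is *core* if these equal $I$ and $J$. In general the core of $p$ is the $(K,L)$-coset with minimal element $\underline p$, where $K,L$ are the left and right redundancies of $p$. An $(I,J)$-expression is a sequence $[I=I_0,\dots,I_d=J]$ of subsets of $S$ in which consecutive sets differ by one element; $[I+s-t\cdots]$ denotes the expression that starts at $I$ and successively adds $s$, removes $t$, and so on. With $K_k=I_{k-1}\cup I_k$, it is a reduced expression for $p$ if $\overline p=w_{K_1}w_{I_1}^{-1}w_{K_2}\cdots w_{I_{d-1}}^{-1}w_{K_d}$ and $\ell(\overline p)=\ell(K_1)-\ell(I_1)+\ell(K_2)-\cdots+\ell(K_d)$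 (for $d=0$: $\overline p=w_I$). A coset is *atomic* if it is core and has a reduced expression $[I+s-t]$ for some $s,t\in S$. An *atomic reduced expression* of $p$ is a reduced expression of $p$ that is a concatenation of (possibly zero) reduced expressions $[I,M,J]$ of atomic cosets. For $J\subset S$ and $1\le i\le \#(S\setminus J)$, let $s$ be the $i$-th element of $S\setminus J$ in increasing order of index, $M=J\cup\{s\}$, $t=w_Msw_M$; $\mathtt a_i^J$ is the atomic coset expressed by $[M\setminus t,M,J]$. In a composite $\mathtt a_{i_d}\cdots \mathtt a_{i_0}^{J}$ the other superscripts are the ones that make the composition well-defined. The *atomic braid relations* replace, inside an expression, a contiguous subexpression $\mathtt a_i\mathtt a_{i+1}\mathtt a_i^J$ by $\mathtt a_{i+1}\mathtt a_i\mathtt a_{i+1}^J$, or $\mathtt a_i\mathtt a_j^J$ by $\mathtt a_j\mathtt a_i^J$ with $|i-j|>1$, or conversely. The following double coset braid relations may be applied to a contiguous subexpression, in either direction. *Upup*: $[I+s+t]\leftrightharpoons[I+t+s]$ for distinct $s,t\notin I$. *Downdown*: $[M-s-t]\leftrightharpoons[M-t-s]$ for distinct $s,t\in M$. *Switchback*: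 for $s,t\in M$ with $t\neq w_Msw_M$, $[M\setminus s,M,M\setminus t]\leftrightharpoons[M\setminus s\supset K]\circ A\circ[L\subset M\setminus t]$, where both sides are reduced expressions of the same coset $p$, $K$ and $L$ are the redundancies of $p$, and $A$ is an atomic reduced expression of the core of $p$. **Theorem.** 1. Let $p$ be a core $(I,J)$-coset. Any two atomic reduced expressions of $p$ are related by a finite sequence of atomic braid relations, all of whose terms are atomic reduced expressions of $p$. 2. Let $J\subset S$ and $1\le i<i+1\le\#(S\setminus J)$. There are $I\subset S$, a core $(I,J)$-coset $p$ and $s_a,\dots,s_f\in S$ such that the following are reduced expressions of $p$, the first and the last being atomic, and each is obtained from the previous one by the indicated relation: $$\mathtt a_i\mathtt a_{i+1}\mathtt a_i^J=[I+s_a-s_b+s_c-s_d+s_b-s_e]\ \overset{\text{switchback}}{\leftrightharpoons}\ [I+s_a+s_c-s_d-s_e]\ \overset{\text{upup}}{\leftrightharpoons}\ [I+s_c+s_a-s_d-s_e]$$ $$\overset{\text{downdown}}{\leftrightharpoons}\ [I+s_c+s_a-s_e-s_d]\ \overset{\text{switchback}}{\leftrightharpoons}\ [I+s_c-s_f+s_a-s_e+s_f-s_d]=\mathtt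 a_{i+1}\mathtt a_i\mathtt a_{i+1}^J .$$ 3. Let $J\subset S$ and $1\le i,j\le\#(S\setminus J)$ with $|i-j|>1$. There are $I\subset S$, a core $(I,J)$-coset $p$ and $s_a,s_b,s_c,s_d\in S$ such that, in the same sense, $$\mathtt a_i\mathtt a_j^J=[I+s_a-s_b+s_c-s_d]\ \overset{\text{switchback}}{\leftrightharpoons}\ [I+s_a+s_c-s_b-s_d]\ \overset{\text{upup}}{\leftrightharpoons}\ [I+s_c+s_a-s_b-s_d]$$ $$\overset{\text{downdown}}{\leftrightharpoons}\ [I+s_c+s_a-s_d-s_b]\ \overset{\text{switchback}}{\leftrightharpoons}\ [I+s_c-s_d+s_a-s_b]=\mathtt a_j\mathtt a_i^J .$$ -/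

import Mathlib

/-! Double cosets in the symmetric group on `n + 1` letters, the Coxeter group of type `A_n`,
with simple reflections `s_i = (i i+1)` indexed by `Fin n`. Subsets of simple reflections are
finsets of indices. All subsets are finitary since the group is finite. -/

namespace AtomicCoset

open scoped Classical in
/-- The Coxeter length of a permutation: its number of inversions. -/
noncomputable def length {n : ℕ} (w : Equiv.Perm (Fin (n + 1))) : ℕ :=
  (Finset.univ.filter fun x : Fin (n + 1) × Fin (n + 1) => x.1 < x.2 ∧ w x.2 < w x.1).card

/-- The simple reflection `s_i`. -/
def simple {n : ℕ} (i : Fin n) : Equiv.Perm (Fin (n + 1)) :=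
  Equiv.swap i.castSucc i.succ

/-- The parabolic subgroup `W_I`. -/
def parabolic {n : ℕ} (I : Finset (Fin n)) : Subgroup (Equiv.Perm (Fin (n + 1))) :=
  Subgroup.closure (simple '' (I : Set (Fin n)))

theorem exists_longest {n : ℕ} (I : Finset (Fin n)) :
    ∃ w ∈ parabolic I, ∀ v ∈ parabolic I, length v ≤ length w :=
  Set.exists_max_image (parabolic I : Set (Equiv.Perm (Fin (n + 1)))) length
    (Set.toFinite _) ⟨1, (parabolic I).one_mem⟩

/-- The longest element `w_I` of `W_I`. -/
noncomputable def longest {n : ℕ} (I : Finset (Fin n)) : Equiv.Perm (Fin (n + 1)) :=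
  (exists_longest I).choose

/-- `p` is an `(I,J)`-coset, that is, an element of `W_I \ W / W_J`. -/
def IsCoset {n : ℕ} (I J : Finset (Fin n)) (p : Set (Equiv.Perm (Fin (n + 1)))) : Prop :=
  ∃ w, p = DoubleCoset.doubleCoset w (parabolic I) (parabolic J)

/-- `x` is the maximal element of `p`. -/
def IsMaxElt {n : ℕ} (p : Set (Equiv.Perm (Fin (n + 1)))) (x : Equiv.Perm (Fin (n + 1))) : Prop :=
  x ∈ p ∧ ∀ y ∈ p, length y ≤ length x

/-- `x` is the minimal element of `p`. -/
def IsMinElt {n : ℕ} (p : Set (Equiv.Perm (Fin (n + 1)))) (x : Equiv.Perm (Fin (n + 1))) : Prop :=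
  x ∈ p ∧ ∀ y ∈ p, length x ≤ length y

open scoped Classical in
/-- The left redundancy `I ∩ x J x⁻¹` of the `(I,J)`-coset with minimal element `x`. -/
noncomputable def leftRed {n : ℕ} (I J : Finset (Fin n)) (x : Equiv.Perm (Fin (n + 1))) :
    Finset (Fin n) :=
  I.filter fun s => ∃ t ∈ J, simple s = x * simple t * x⁻¹

open scoped Classical in
/-- The right redundancy `x⁻¹ I x ∩ J` of the `(I,J)`-coset with minimal element `x`. -/
noncomputable def rightRed {n : ℕ} (I J : Finset (Fin n)) (x : Equiv.Perm (Fin (n + 1))) :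
    Finset (Fin n) :=
  J.filter fun t => ∃ s ∈ I, simple t = x⁻¹ * simple s * x

/-- `p` is a core `(I,J)`-coset. -/
def IsCore {n : ℕ} (I J : Finset (Fin n)) (p : Set (Equiv.Perm (Fin (n + 1)))) : Prop :=
  IsCoset I J p ∧ ∃ x, IsMinElt p x ∧ leftRed I J x = I ∧ rightRed I J x = J

/-- The `(K,L)`-coset `q` is the core of the `(I,J)`-coset `p`. -/
def IsCoreOf {n : ℕ} (I J : Finset (Fin n)) (p : Set (Equiv.Perm (Fin (n + 1))))
    (K L : Finset (Fin n)) (q : Set (Equiv.Perm (Fin (n + 1)))) : Prop :=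
  IsCoset I J p ∧ IsCoset K L q ∧
    ∃ x, IsMinElt p x ∧ IsMinElt q x ∧ K = leftRed I J x ∧ L = rightRed I J x

/-! ### Expressions -/

/-- `I` and `J` differ by adding or removing one simple reflection. -/
def Adjacent {n : ℕ} (I J : Finset (Fin n)) : Prop :=
  (∃ s, s ∉ I ∧ J = insert s I) ∨ (∃ s, s ∈ I ∧ J = I.erase s)

/-- `[I_0, ..., I_d]` is a (singlestep) `(I,J)`-expression. -/
def IsExpression {n : ℕ} (I J : Finset (Fin n)) (E : List (Finset (Fin n))) : Prop :=
  E.head? = some I ∧ E.getLast? = some J ∧ E.IsChain Adjacent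

/-- For `[I_0, ..., I_d]`, viewed as the multistep expression
`[[I_0 ⊂ K_1 ⊃ I_1 ⊂ ... ⊂ K_d ⊃ I_d]]` with `K_k = I_{k-1} ∪ I_k`, this is the product
`w_{K_1} w_{I_1}⁻¹ w_{K_2} ⋯ w_{I_{d-1}}⁻¹ w_{K_d}` (multiplied by `w_{I_d}⁻¹ w_{I_d} = 1`);
for `[I]` it is `w_I`. -/
noncomputable def exprProd {n : ℕ} : List (Finset (Fin n)) → Equiv.Perm (Fin (n + 1))
  | [] => 1
  | [I] => longest I
  | I :: J :: E => longest (I ∪ J) * (longest J)⁻¹ * exprProd (J :: E)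

/-- The alternating sum `ℓ(K_1) - ℓ(I_1) + ℓ(K_2) - ⋯ + ℓ(K_d)` for `[I_0, ..., I_d]`, with `K_k`
as in `exprProd` and `ℓ(I) = ℓ(w_I)`; for `[I]` it is `ℓ(I)`. -/
noncomputable def exprLength {n : ℕ} : List (Finset (Fin n)) → ℤ
  | [] => 0
  | [I] => length (longest I)
  | I :: J :: E => length (longest (I ∪ J)) - length (longest J) + exprLength (J :: E)

/-- `E` is a reduced expression for the `(I,J)`-coset `p`. -/
def IsReducedExpr {n : ℕ} (I J : Finset (Fin n)) (p : Set (Equiv.Perm (Fin (n + 1))))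
    (E : List (Finset (Fin n))) : Prop :=
  IsCoset I J p ∧ IsExpression I J E ∧ IsMaxElt p (exprProd E) ∧
    (length (exprProd E) : ℤ) = exprLength E

/-- A step `+ s` or `- s` of a singlestep expression. -/
inductive Step (n : ℕ) : Type
  | add (s : Fin n)
  | sub (s : Fin n)

/-- The list of subsets written `[I + s - t + ⋯]`. -/
def walk {n : ℕ} (I : Finset (Fin n)) : List (Step n) → List (Finset (Fin n))
  | [] => [I]
  | Step.add s :: l => I :: walk (insert s I) l
  | Step.sub s :: l => I :: walk (I.erase s) l

/-! ### Atomic cosets and atomic expressions -/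

/-- `p` is an atomic `(I,J)`-coset: it is core and has a reduced expression `[I + s - t]`. -/
def IsAtomic {n : ℕ} (I J : Finset (Fin n)) (p : Set (Equiv.Perm (Fin (n + 1)))) : Prop :=
  IsCore I J p ∧ ∃ s t, IsReducedExpr I J p (walk I [Step.add s, Step.sub t])

/-- `E` is a composition of (possibly no) reduced expressions `[I, M, J]` of atomic cosets. -/
inductive IsAtomicExpr {n : ℕ} : List (Finset (Fin n)) → Prop
  | nil (I : Finset (Fin n)) : IsAtomicExpr [I]
  | cons (I M J : Finset (Fin n)) (E : List (Finset (Fin n)))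
      (q : Set (Equiv.Perm (Fin (n + 1)))) (hq : IsAtomic I J q)
      (hr : IsReducedExpr I J q [I, M, J]) (hE : IsAtomicExpr (J :: E)) :
      IsAtomicExpr (I :: M :: J :: E)

/-- `E` is an atomic reduced expression for the `(I,J)`-coset `p`. -/
def IsAtomicReducedExpr {n : ℕ} (I J : Finset (Fin n)) (p : Set (Equiv.Perm (Fin (n + 1))))
    (E : List (Finset (Fin n))) : Prop :=
  IsReducedExpr I J p E ∧ IsAtomicExpr E

/-- `[I, M, J]` is the expression `[Js \ t, Js, J]` of `a_i^J`: here `s` is the `i`-th element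
of `S \ J` in increasing order (counted from `1`) and `t = w_{Js} s w_{Js}`. -/
def IsAtom {n : ℕ} (i : ℕ) (I M J : Finset (Fin n)) : Prop :=
  ∃ s t, s ∉ J ∧ (Finset.univ.filter fun r => r ∉ J ∧ r ≤ s).card = i ∧ M = insert s J ∧
    t ∈ M ∧ simple t = longest M * simple s * longest M ∧ I = M.erase t

/-- `E` is the composite of the expressions of the atomic cosets `a_{i_d} * ⋯ * a_{i_0}^J`, where
`[i_d, ..., i_0]` is the given list of indices. -/
inductive IsAtomWord {n : ℕ} (J : Finset (Fin n)) : List ℕ → List (Finset (Fin n)) → Prop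
  | nil : IsAtomWord J [] [J]
  | cons (i : ℕ) (is : List ℕ) (I M K : Finset (Fin n)) (E : List (Finset (Fin n)))
      (h : IsAtom i I M K) (hE : IsAtomWord J is (K :: E)) :
      IsAtomWord J (i :: is) (I :: M :: K :: E)

/-- The atomic braid relations `a_i a_{i+1} a_i ↔ a_{i+1} a_i a_{i+1}` and `a_i a_j ↔ a_j a_i`
for `|i - j| > 1`. -/
inductive AtomicBraid {n : ℕ} : List (Finset (Fin n)) → List (Finset (Fin n)) → Prop
  | braid (J : Finset (Fin n)) (i : ℕ) (X Y : List (Finset (Fin n)))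
      (hX : IsAtomWord J [i, i + 1, i] X) (hY : IsAtomWord J [i + 1, i, i + 1] Y) :
      AtomicBraid X Y
  | comm (J : Finset (Fin n)) (i j : ℕ) (hij : i + 1 < j ∨ j + 1 < i)
      (X Y : List (Finset (Fin n)))
      (hX : IsAtomWord J [i, j] X) (hY : IsAtomWord J [j, i] Y) :
      AtomicBraid X Y

/-- `F` is obtained from `E` by replacing a contiguous subexpression `X` by `Y`, where `R X Y`. -/
def InContext {n : ℕ} (R : List (Finset (Fin n)) → List (Finset (Fin n)) → Prop)
    (E F : List (Finset (Fin n))) : Prop :=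
  ∃ A X Y B, R X Y ∧ E = A ++ X ++ B ∧ F = A ++ Y ++ B

/-- One application, in either direction, of an atomic braid relation between atomic reduced
expressions of `p`. -/
def AtomicMove {n : ℕ} (I J : Finset (Fin n)) (p : Set (Equiv.Perm (Fin (n + 1))))
    (E F : List (Finset (Fin n))) : Prop :=
  IsAtomicReducedExpr I J p E ∧ IsAtomicReducedExpr I J p F ∧
    (InContext AtomicBraid E F ∨ InContext AtomicBraid F E)

/-! ### Double coset braid relations -/

/-- The upup relation `[I + s + t] ⇌ [I + t + s]`. -/
def UpUp {n : ℕ} (X Y : List (Finset (Fin n))) : Prop :=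
  ∃ I s t, s ∉ I ∧ t ∉ I ∧ s ≠ t ∧
    X = walk I [Step.add s, Step.add t] ∧ Y = walk I [Step.add t, Step.add s]

/-- The downdown relation `[M - s - t] ⇌ [M - t - s]`. -/
def DownDown {n : ℕ} (X Y : List (Finset (Fin n))) : Prop :=
  ∃ M s t, s ∈ M ∧ t ∈ M ∧ s ≠ t ∧
    X = walk M [Step.sub s, Step.sub t] ∧ Y = walk M [Step.sub t, Step.sub s]

/-- The switchback relation: for `s, t ∈ M` with `t ≠ w_M s w_M`, it relates `[M \ s, M, M \ t]`,
expressing `p`, to the reduced expression `[[M \ s ⊃ K]] ∘ A ∘ [[L ⊂ M \ t]]` of `p`, where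
`A` is an atomic reduced expression of the core of `p`, which is a `(K,L)`-coset. -/
def Switchback {n : ℕ} (X Y : List (Finset (Fin n))) : Prop :=
  ∃ (M : Finset (Fin n)) (s t : Fin n) (p : Set (Equiv.Perm (Fin (n + 1))))
    (K L : Finset (Fin n)) (q : Set (Equiv.Perm (Fin (n + 1)))) (A : List (Finset (Fin n))),
    s ∈ M ∧ t ∈ M ∧ simple t ≠ longest M * simple s * longest M ∧
    X = [M.erase s, M, M.erase t] ∧ IsReducedExpr (M.erase s) (M.erase t) p X ∧
    IsCoreOf (M.erase s) (M.erase t) p K L q ∧ IsAtomicReducedExpr K L q A ∧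
    Y = [M.erase s] ++ A ++ [M.erase t] ∧ IsReducedExpr (M.erase s) (M.erase t) p Y

end AtomicCoset

open AtomicCoset AtomicCoset.Step

namespace AtomicCoset

variable {n : ℕ}

/-! ### Blocks of a subset of simple reflections -/

/-! A set `J` of simple reflections cuts the `n + 1` letters into intervals, the blocks, one more
than there are elements of `S \ J`, and `W_J` permutes letters inside blocks. Suppose `x` carries
the blocks of `J` onto those of `I`, increasingly on each. Then conjugation by `x` matches the
simple reflections of `J` with those of `I`, so the `(I,J)`-coset of `x` is just `x W_J`: it is
core, with minimal element `x` and maximal element `x w_J`. Such an `x` is determined by `J` and the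
permutation of block numbers it induces (`Rep`, `Rep.perm_eq`), and then so is `I` (`Rep.left_eq`).

The coset `a_i^J` swaps the blocks `i` and `i + 1` (`AtomData.rep`), and every atomic coset is of
this kind (`IsAtomic.exists_atomData`). Atomic expressions ending in `J` are therefore words in the
adjacent transpositions of block numbers. Counting the inversions cancelled by each atom shows that
the expression is reduced exactly when the word is (`IsAtomWord.exists_rep`). The first claim
becomes Matsumoto's theorem for symmetric groups (`braidEquiv_of_wordPerm_eq`), whose moves lift to
expressions by `IsAtomWord.braidStep`.

For the other two claims let `Q` be `J` together with the two elements of `S \ J` with the given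
indices. The block permutation reverses the blocks inside every block of `Q`, so the maximal element
of the coset is `w_Q` (`Rep.mul_longest_eq`). An expression climbing from `I` to `Q` and descending
to `J` has telescoping product `w_Q`, so it is reduced; upup and downdown only reorder the two
slopes. Removing the two ends of the atomic expression leaves its product unchanged, and what
remains is the other side of a switchback at the peak `Q`. The core there is the identity coset in
the commuting case (`switchback_trivial`) and a single atom in the braid case (`switchback_atom`).
-/

/-- The block of `J` containing `p`, where the blocks are the orbits of `W_J`, numbered from left
to right starting with `1`. -/
def blk {n : ℕ} (J : Finset (Fin n)) (p : Fin (n + 1)) : ℕ :=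
  1 + (Jᶜ.filter fun c => c.castSucc < p).card


theorem one_le_blk (J : Finset (Fin n)) (p : Fin (n + 1)) : 1 ≤ blk J p := by
  simp [blk]

theorem blk_mono (J : Finset (Fin n)) {p q : Fin (n + 1)} (h : p ≤ q) : blk J p ≤ blk J q := by
  unfold blk
  gcongr

theorem lt_of_blk_lt {J : Finset (Fin n)} {p q : Fin (n + 1)} (h : blk J p < blk J q) : p < q := by
  by_contra! h'
  exact absurd (blk_mono J h') (by omega)

theorem blk_zero (J : Finset (Fin n)) : blk J 0 = 1 := by
  simp [blk]

theorem blk_last (J : Finset (Fin n)) : blk J (Fin.last n) = Jᶜ.card + 1 := by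
  simp [blk, Fin.castSucc_lt_last, add_comm]

theorem blk_succ_of_mem {J : Finset (Fin n)} {t : Fin n} (h : t ∈ J) :
    blk J t.succ = blk J t.castSucc := by
  unfold blk
  congr 2
  ext c
  simp only [Finset.mem_filter, Finset.mem_compl, Fin.castSucc_lt_succ_iff, Fin.castSucc_lt_castSucc_iff]
  refine and_congr_right fun hc => ⟨fun h' => lt_of_le_of_ne h' ?_, le_of_lt⟩
  rintro rfl
  exact hc h

theorem blk_succ_of_notMem {J : Finset (Fin n)} {t : Fin n} (h : t ∉ J) :
    blk J t.succ = blk J t.castSucc + 1 := by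
  unfold blk
  rw [add_assoc, ← Finset.card_insert_of_notMem (a := t)]
  · congr 2
    ext c
    simp only [Finset.mem_filter, Finset.mem_compl, Fin.castSucc_lt_succ_iff,
      Fin.castSucc_lt_castSucc_iff, Finset.mem_insert, le_iff_lt_or_eq]
    constructor
    · rintro ⟨h1, h2 | h2⟩ <;> tauto
    · rintro (rfl | h2) <;> tauto
  · simp

theorem blk_succ_eq_iff {J : Finset (Fin n)} {t : Fin n} :
    blk J t.succ = blk J t.castSucc ↔ t ∈ J := by
  refine ⟨fun h => ?_, blk_succ_of_mem⟩
  by_contra h'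
  rw [blk_succ_of_notMem h'] at h
  omega

theorem blk_insert {J : Finset (Fin n)} {s : Fin n} (h : s ∉ J) (p : Fin (n + 1)) :
    blk J p = blk (insert s J) p + if s.castSucc < p then 1 else 0 := by
  unfold blk
  have : Jᶜ = insert s (insert s J)ᶜ := by
    ext c
    by_cases hc : c = s <;> simp [hc, h]
  rw [this, Finset.filter_insert]
  split_ifs with h1
  · rw [Finset.card_insert_of_notMem (by simp)]
    ring
  · rfl

theorem blk_le_of_subset {I J : Finset (Fin n)} (h : I ⊆ J) {p q : Fin (n + 1)}
    (hb : blk I p = blk I q) : blk J p = blk J q := by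
  wlog hpq : p ≤ q generalizing p q
  · exact (this hb.symm (le_of_not_ge hpq)).symm
  unfold blk at *
  congr 1
  refine le_antisymm ?_ ?_
  · gcongr
  · have h1 : (Iᶜ.filter fun c => c.castSucc < p) = Iᶜ.filter fun c => c.castSucc < q := by
      refine Finset.eq_of_subset_of_card_le ?_ (by omega)
      gcongr
    refine Finset.card_le_card fun c hc => ?_
    have := Finset.ext_iff.1 h1 c
    simp only [Finset.mem_filter, Finset.mem_compl] at this hc ⊢
    exact ⟨hc.1, (this.2 ⟨fun hI => hc.1 (h hI), hc.2⟩).2⟩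

/-- Letters of one block are joined by steps `t, t + 1` with `t ∈ J`, so a transitive relation need
only be checked on those steps. This is how monotonicity on simple reflections becomes monotonicity
on blocks. -/
theorem rel_of_blk_eq {J : Finset (Fin n)} {R : Fin (n + 1) → Fin (n + 1) → Prop}
    (hR : ∀ a b c, R a b → R b c → R a c) (h : ∀ t ∈ J, R t.castSucc t.succ)
    {p q : Fin (n + 1)} (hb : blk J p = blk J q) (hpq : p < q) : R p q := by
  induction q using Fin.induction with
  | zero => exact absurd hpq (Fin.not_lt_zero _)
  | succ t ih =>
    have h1 : p ≤ t.castSucc := Fin.le_castSucc_iff.2 hpq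
    have h2 := blk_mono J h1
    have h3 := blk_mono J (Fin.castSucc_lt_succ (i := t)).le
    have ht : t ∈ J := blk_succ_eq_iff.1 (by omega)
    rcases h1.eq_or_lt with rfl | h1
    · exact h t ht
    · exact hR _ _ _ (ih (by omega) h1) (h t ht)

/-- The `i`-th element of `S \ J`. -/
def IsCut (J : Finset (Fin n)) (i : ℕ) (r : Fin n) : Prop := r ∉ J ∧ blk J r.castSucc = i

theorem IsCut.succ {J : Finset (Fin n)} {i : ℕ} {r : Fin n} (h : IsCut J i r) :
    blk J r.succ = i + 1 := by
  rw [blk_succ_of_notMem h.1, h.2]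

theorem IsCut.le_iff {J : Finset (Fin n)} {i : ℕ} {r : Fin n} (h : IsCut J i r)
    (p : Fin (n + 1)) : p ≤ r.castSucc ↔ blk J p ≤ i := by
  constructor
  · intro hp
    exact (blk_mono J hp).trans h.2.le
  · intro hp
    by_contra! h'
    have := blk_mono J (Fin.castSucc_lt_iff_succ_le.1 h')
    rw [h.succ] at this
    omega

theorem IsCut.lt_iff {J : Finset (Fin n)} {i : ℕ} {r : Fin n} (h : IsCut J i r)
    (p : Fin (n + 1)) : r.castSucc < p ↔ i < blk J p := by
  have := h.le_iff p
  rw [← not_le, this, not_le]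

theorem IsCut.unique {J : Finset (Fin n)} {i : ℕ} {r r' : Fin n} (h : IsCut J i r)
    (h' : IsCut J i r') : r = r' := by
  apply Fin.castSucc_injective
  exact le_antisymm ((h'.le_iff _).2 h.2.le) ((h.le_iff _).2 h'.2.le)

theorem exists_isCut {J : Finset (Fin n)} {i : ℕ} (h1 : 1 ≤ i) (h2 : i ≤ Jᶜ.card) :
    ∃ r, IsCut J i r := by
  have key : ∀ p : Fin (n + 1), i < blk J p → ∃ r, IsCut J i r := by
    intro p
    induction p using Fin.induction with
    | zero => intro h; rw [blk_zero] at h; omega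
    | succ t ih =>
      intro h
      by_cases h' : i < blk J t.castSucc
      · exact ih h'
      · by_cases ht : t ∈ J
        · rw [blk_succ_of_mem ht] at h
          exact absurd h h'
        · rw [blk_succ_of_notMem ht] at h
          exact ⟨t, ht, by omega⟩
  exact key (Fin.last n) (by rw [blk_last]; omega)

theorem IsCut.bounds {J : Finset (Fin n)} {i : ℕ} {r : Fin n} (h : IsCut J i r) :
    1 ≤ i ∧ i ≤ Jᶜ.card := by
  refine ⟨h.2 ▸ one_le_blk _ _, ?_⟩
  have := blk_mono J (Fin.le_last r.succ)
  rw [h.succ, blk_last] at this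
  omega

theorem isCut_iff_card {J : Finset (Fin n)} {i : ℕ} {s : Fin n} :
    IsCut J i s ↔ s ∉ J ∧ (Finset.univ.filter fun r => r ∉ J ∧ r ≤ s).card = i := by
  refine and_congr_right fun hs => ?_
  have : (Finset.univ.filter fun r => r ∉ J ∧ r ≤ s)
      = insert s (Jᶜ.filter fun c => c.castSucc < s.castSucc) := by
    ext c
    simp only [Finset.mem_filter, Finset.mem_univ, true_and, Finset.mem_insert, Finset.mem_compl,
      Fin.castSucc_lt_castSucc_iff, le_iff_lt_or_eq]
    constructor
    · rintro ⟨h1, h2 | h2⟩ <;> tauto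
    · rintro (rfl | h2) <;> tauto
  rw [this, Finset.card_insert_of_notMem (by simp), blk, add_comm]

/-! ### Permutations and inversions -/

/-- A permutation is determined by its inversions: under the hypothesis `y ∘ x⁻¹` is strictly
increasing, hence the identity. -/
theorem perm_eq_of_lt_iff {x y : Equiv.Perm (Fin (n + 1))}
    (h : ∀ p q, p < q → (x p < x q ↔ y p < y q)) : x = y := by
  have h' : ∀ p q, x p < x q → y p < y q := by
    intro p q hx
    rcases lt_trichotomy p q with hpq | rfl | hpq
    · exact (h p q hpq).1 hx
    · exact absurd hx (lt_irrefl _)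
    · by_contra! hy
      rcases hy.eq_or_lt with hy | hy
      · exact hpq.ne (y.injective hy)
      · exact absurd ((h q p hpq).2 hy) (not_lt.2 hx.le)
  have hs : StrictMono (y ∘ x.symm) := fun p q hpq => h' _ _ (by simpa using hpq)
  have := (StrictMono.range_inj hs strictMono_id).1 (by
    rw [Set.range_id, (y.surjective.comp x.symm.surjective).range_eq])
  ext p
  have := congrFun this (x p)
  simp only [Function.comp_apply, Equiv.symm_apply_apply, id_eq] at this
  rw [this]

open scoped Classical in
/-- The number of inversions of `v` that become non-inversions in `u * v`. -/
noncomputable def cancel (u v : Equiv.Perm (Fin (n + 1))) : ℕ :=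
  (Finset.univ.filter fun x : Fin (n + 1) × Fin (n + 1) =>
    x.1 < x.2 ∧ v x.2 < v x.1 ∧ u (v x.1) < u (v x.2)).card

/-- An inversion of `v` undone by `u` is counted once in each length on the left and not at all in
`length (u * v)`; any other pair contributes equally to both sides. To compare pair by pair, the
inversions of `u` are reindexed through `v`. -/
theorem length_add_length (u v : Equiv.Perm (Fin (n + 1))) :
    length u + length v = length (u * v) + 2 * cancel u v := by
  classical
  have h1 : length u = ∑ x : Fin (n + 1) × Fin (n + 1),
      (if x.1 < x.2 ∧ v x.1 < v x.2 ∧ u (v x.2) < u (v x.1) then 1 else 0) + cancel u v := by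
    rw [length, Finset.card_filter, ← Equiv.sum_comp (Equiv.prodCongr v v)]
    have h2 : cancel u v = ∑ x : Fin (n + 1) × Fin (n + 1),
        (if x.2 < x.1 ∧ v x.1 < v x.2 ∧ u (v x.2) < u (v x.1) then 1 else 0) := by
      rw [cancel, Finset.card_filter, ← Equiv.sum_comp (Equiv.prodComm _ _)]
      rfl
    rw [h2, ← Finset.sum_add_distrib]
    refine Finset.sum_congr rfl fun ⟨p, q⟩ _ => ?_
    simp only [Equiv.prodCongr_apply, Prod.map_apply]
    rcases lt_trichotomy p q with h | rfl | h
    · simp [h, h.not_gt]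
    · simp
    · simp [h, h.not_gt]
  rw [h1]
  simp only [length, cancel, Finset.card_filter, Finset.mul_sum, ← Finset.sum_add_distrib]
  refine Finset.sum_congr rfl fun ⟨p, q⟩ _ => ?_
  simp only [Equiv.Perm.mul_apply]
  by_cases h : p < q
  · have a1 : v p < v q ∨ v q < v p := lt_or_gt_of_ne (v.injective.ne h.ne)
    have a2 : u (v p) < u (v q) ∨ u (v q) < u (v p) :=
      lt_or_gt_of_ne (u.injective.ne (v.injective.ne h.ne))
    rcases a1 with a1 | a1 <;> rcases a2 with a2 | a2 <;> simp [h, a1, a2, a1.not_gt, a2.not_gt]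
  · simp [h]

theorem cancel_eq_zero_iff {u v : Equiv.Perm (Fin (n + 1))} :
    cancel u v = 0 ↔ ∀ p q, p < q → v q < v p → u (v q) < u (v p) := by
  classical
  rw [cancel, Finset.card_eq_zero, Finset.filter_eq_empty_iff]
  constructor
  · intro h p q hpq hv
    have := h (Finset.mem_univ (p, q))
    simp only [hpq, hv, true_and, not_lt] at this
    exact lt_of_le_of_ne this (u.injective.ne hv.ne)
  · rintro h ⟨p, q⟩ - ⟨h1, h2, h3⟩
    exact absurd (h p q h1 h2) h3.not_gt

theorem length_mul_of {u v : Equiv.Perm (Fin (n + 1))}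
    (h : ∀ p q, p < q → v q < v p → u (v q) < u (v p)) :
    length (u * v) = length u + length v := by
  have := length_add_length u v
  rw [cancel_eq_zero_iff.2 h] at this
  omega

theorem simple_castSucc (t : Fin n) : simple t t.castSucc = t.succ := Equiv.swap_apply_left _ _

theorem simple_succ (t : Fin n) : simple t t.succ = t.castSucc := Equiv.swap_apply_right _ _

theorem lt_length_mul_simple {w : Equiv.Perm (Fin (n + 1))} {t : Fin n}
    (h : w t.castSucc < w t.succ) : length w < length (w * simple t) := by
  have h1 : length (w * simple t) = length w + length (simple t) := by
    refine length_mul_of fun p q hpq hs => ?_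
    have : p = t.castSucc ∧ q = t.succ := by
      rw [simple, Equiv.swap_apply_def, Equiv.swap_apply_def] at hs
      simp only [Fin.lt_def, Fin.ext_iff] at *
      split_ifs at hs <;> simp_all <;> omega
    rw [this.1, this.2, simple_castSucc, simple_succ]
    exact h
  have h2 := length_add_length (simple t) (simple t)
  have h3 : length (simple t) ≠ 0 := by
    intro h0
    classical
    rw [length, Finset.card_eq_zero, Finset.filter_eq_empty_iff] at h0
    refine h0 (Finset.mem_univ (t.castSucc, t.succ)) ⟨Fin.castSucc_lt_succ, ?_⟩
    rw [simple_castSucc, simple_succ]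
    exact Fin.castSucc_lt_succ
  omega

theorem conj_simple (w : Equiv.Perm (Fin (n + 1))) (t : Fin n) :
    w * simple t * w⁻¹ = Equiv.swap (w t.castSucc) (w t.succ) := by
  rw [simple, Equiv.swap_apply_apply]

theorem swap_eq_simple {a b : Fin (n + 1)} {s : Fin n} (h : simple s = Equiv.swap a b) :
    (a = s.castSucc ∧ b = s.succ) ∨ (a = s.succ ∧ b = s.castSucc) := by
  have h1 : Equiv.swap a b s.castSucc = s.succ := by rw [← h, simple_castSucc]
  have hne : s.succ ≠ s.castSucc := Fin.castSucc_lt_succ.ne'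
  rw [Equiv.swap_apply_def] at h1
  split_ifs at h1 with h2 h3
  · exact Or.inl ⟨h2.symm, h1⟩
  · exact Or.inr ⟨h1, h3.symm⟩
  · exact absurd h1.symm hne

theorem simple_injective : Function.Injective (simple (n := n)) := by
  intro s t h
  rcases swap_eq_simple (h.symm.trans (rfl : simple s = _)) with h' | h'
  · exact Fin.castSucc_injective _ h'.1
  · have h1 := congrArg Fin.val h'.1
    have h2 := congrArg Fin.val h'.2
    simp only [Fin.val_castSucc, Fin.val_succ] at h1 h2
    omega

/-! ### Parabolic subgroups and their longest elements -/

theorem simple_mem_parabolic {J : Finset (Fin n)} {t : Fin n} (h : t ∈ J) :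
    simple t ∈ parabolic J :=
  Subgroup.subset_closure ⟨t, h, rfl⟩

theorem parabolic_mono {I J : Finset (Fin n)} (h : I ⊆ J) : parabolic I ≤ parabolic J :=
  Subgroup.closure_mono (Set.image_mono (by exact_mod_cast h))

theorem blk_apply_simple {J : Finset (Fin n)} {t : Fin n} (h : t ∈ J) (p : Fin (n + 1)) :
    blk J (simple t p) = blk J p := by
  rw [simple, Equiv.swap_apply_def]
  split_ifs with h1 h2
  · rw [h1, blk_succ_of_mem h]
  · rw [h2, blk_succ_of_mem h]
  · rfl

theorem blk_apply {J : Finset (Fin n)} {w : Equiv.Perm (Fin (n + 1))} (h : w ∈ parabolic J) :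
    ∀ p, blk J (w p) = blk J p := by
  induction h using Subgroup.closure_induction with
  | mem x hx =>
    obtain ⟨t, ht, rfl⟩ := hx
    exact blk_apply_simple ht
  | one => intro p; rfl
  | mul x y _ _ hx hy => intro p; rw [Equiv.Perm.mul_apply, hx, hy]
  | inv x _ hx => intro p; rw [← hx, ← Equiv.Perm.mul_apply, mul_inv_cancel, Equiv.Perm.one_apply]

theorem simple_mem_parabolic_iff {J : Finset (Fin n)} {t : Fin n} :
    simple t ∈ parabolic J ↔ t ∈ J := by
  refine ⟨fun h => ?_, simple_mem_parabolic⟩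
  have := blk_apply h t.castSucc
  rwa [simple_castSucc, blk_succ_eq_iff] at this

/-- `x` is increasing on the blocks of `J`. -/
def IncOn (J : Finset (Fin n)) (x : Equiv.Perm (Fin (n + 1))) : Prop :=
  ∀ t ∈ J, x t.castSucc < x t.succ

/-- `x` is decreasing on the blocks of `J`. -/
def DecOn (J : Finset (Fin n)) (x : Equiv.Perm (Fin (n + 1))) : Prop :=
  ∀ t ∈ J, x t.succ < x t.castSucc

theorem IncOn.lt {J : Finset (Fin n)} {x : Equiv.Perm (Fin (n + 1))} (h : IncOn J x)
    {p q : Fin (n + 1)} (hb : blk J p = blk J q) (hpq : p < q) : x p < x q :=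
  rel_of_blk_eq (R := fun p q => x p < x q) (fun _ _ _ => lt_trans) h hb hpq

theorem DecOn.lt {J : Finset (Fin n)} {x : Equiv.Perm (Fin (n + 1))} (h : DecOn J x)
    {p q : Fin (n + 1)} (hb : blk J p = blk J q) (hpq : p < q) : x q < x p :=
  rel_of_blk_eq (R := fun p q => x q < x p) (fun _ _ _ h1 h2 => h2.trans h1) h hb hpq

theorem decOn_of_max {J : Finset (Fin n)} {w : Equiv.Perm (Fin (n + 1))} (hw : w ∈ parabolic J)
    (h : ∀ v ∈ parabolic J, length v ≤ length w) : DecOn J w := by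
  intro t ht
  by_contra! h'
  have h1 := lt_of_le_of_ne h' (w.injective.ne Fin.castSucc_lt_succ.ne)
  exact absurd (h _ (mul_mem hw (simple_mem_parabolic ht))) (not_le.2 (lt_length_mul_simple h1))

theorem longest_mem (J : Finset (Fin n)) : longest J ∈ parabolic J :=
  (exists_longest J).choose_spec.1

theorem length_le_longest {J : Finset (Fin n)} {v : Equiv.Perm (Fin (n + 1))}
    (h : v ∈ parabolic J) : length v ≤ length (longest J) :=
  (exists_longest J).choose_spec.2 v h

theorem longest_decOn (J : Finset (Fin n)) : DecOn J (longest J) :=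
  decOn_of_max (longest_mem J) fun _ => length_le_longest

theorem blk_longest (J : Finset (Fin n)) (p : Fin (n + 1)) : blk J (longest J p) = blk J p :=
  blk_apply (longest_mem J) p

/-- Block preservation fixes the order of images across blocks and `DecOn` fixes it inside them, so
the inversions of `w` are those of `w_J`. Later identifications of products with longest elements go
through this criterion. -/
theorem eq_longest {J : Finset (Fin n)} {w : Equiv.Perm (Fin (n + 1))}
    (h1 : ∀ p, blk J (w p) = blk J p) (h2 : DecOn J w) : w = longest J := by
  refine perm_eq_of_lt_iff fun p q hpq => ?_
  rcases (blk_mono J hpq.le).eq_or_lt with hb | hb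
  · exact iff_of_false (h2.lt hb hpq).not_gt ((longest_decOn J).lt hb hpq).not_gt
  · refine iff_of_true (lt_of_blk_lt (J := J) ?_) (lt_of_blk_lt (J := J) ?_)
    · rwa [h1, h1]
    · rwa [blk_longest, blk_longest]

theorem eq_one_of_incOn {J : Finset (Fin n)} {w : Equiv.Perm (Fin (n + 1))}
    (h1 : ∀ p, blk J (w p) = blk J p) (h2 : IncOn J w) : w = 1 := by
  refine perm_eq_of_lt_iff fun p q hpq => iff_of_true ?_ hpq
  rcases (blk_mono J hpq.le).eq_or_lt with hb | hb
  · exact h2.lt hb hpq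
  · exact lt_of_blk_lt (J := J) (by rwa [h1, h1])

theorem longest_mul_self (J : Finset (Fin n)) : longest J * longest J = 1 := by
  refine eq_one_of_incOn (J := J) (fun p => ?_) fun t ht => ?_
  · rw [Equiv.Perm.mul_apply, blk_longest, blk_longest]
  · refine (longest_decOn J).lt ?_ (longest_decOn J t ht)
    rw [blk_longest, blk_longest, blk_succ_of_mem ht]

theorem longest_inv (J : Finset (Fin n)) : (longest J)⁻¹ = longest J :=
  inv_eq_of_mul_eq_one_left (longest_mul_self J)

theorem longest_apply_longest (J : Finset (Fin n)) (p : Fin (n + 1)) :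
    longest J (longest J p) = p := by
  rw [← Equiv.Perm.mul_apply, longest_mul_self, Equiv.Perm.one_apply]

theorem longest_lt_longest_iff {J : Finset (Fin n)} {p q : Fin (n + 1)} (h : blk J p = blk J q) :
    longest J p < longest J q ↔ q < p := by
  rcases lt_trichotomy p q with h' | rfl | h'
  · exact iff_of_false ((longest_decOn J).lt h h').not_gt h'.not_gt
  · simp
  · exact iff_of_true ((longest_decOn J).lt h.symm h') h'

/-! ### Block permutations -/

/-- `x` maps the blocks of `J` onto the blocks of `I`, permuting them by `π`, and is increasing on
each block of `J`. -/
structure Rep (I J : Finset (Fin n)) (π : Equiv.Perm ℕ) (x : Equiv.Perm (Fin (n + 1))) : Prop where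
  blk_eq : ∀ p, blk I (x p) = π (blk J p)
  inc : IncOn J x

theorem Rep.one (J : Finset (Fin n)) : Rep J J 1 1 :=
  ⟨fun _ => rfl, fun _ _ => Fin.castSucc_lt_succ⟩

theorem Rep.blk_eq_blk {I J : Finset (Fin n)} {π : Equiv.Perm ℕ} {x : Equiv.Perm (Fin (n + 1))}
    (h : Rep I J π x) {p q : Fin (n + 1)} : blk I (x p) = blk I (x q) ↔ blk J p = blk J q := by
  rw [h.blk_eq, h.blk_eq, π.injective.eq_iff]

theorem Rep.mul {I K J : Finset (Fin n)} {σ π : Equiv.Perm ℕ} {y x : Equiv.Perm (Fin (n + 1))}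
    (hy : Rep I K σ y) (hx : Rep K J π x) : Rep I J (σ * π) (y * x) := by
  refine ⟨fun p => ?_, fun t ht => hy.inc.lt ?_ (hx.inc t ht)⟩
  · rw [Equiv.Perm.mul_apply, hy.blk_eq, hx.blk_eq, Equiv.Perm.mul_apply]
  · rw [hx.blk_eq_blk, blk_succ_of_mem ht]

/-- The inversions of `x` can be read from `π` and `J`: pairs in one block are never inverted, and
pairs in different blocks are ordered as `π` orders the blocks. The target `I` plays no role, so it
may differ between the two representatives. -/
theorem Rep.perm_eq {I I' J : Finset (Fin n)} {π : Equiv.Perm ℕ} {x y : Equiv.Perm (Fin (n + 1))}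
    (hx : Rep I J π x) (hy : Rep I' J π y) : x = y := by
  have key : ∀ {I : Finset (Fin n)} {x : Equiv.Perm (Fin (n + 1))}, Rep I J π x →
      ∀ p q, blk J p ≠ blk J q → (x p < x q ↔ π (blk J p) < π (blk J q)) := by
    intro I x h p q hb
    rw [← h.blk_eq, ← h.blk_eq]
    refine ⟨fun hl => lt_of_le_of_ne (blk_mono I hl.le) ?_, lt_of_blk_lt⟩
    rwa [Ne, h.blk_eq_blk]
  refine perm_eq_of_lt_iff fun p q hpq => ?_
  by_cases hb : blk J p = blk J q
  · exact iff_of_true (hx.inc.lt hb hpq) (hy.inc.lt hb hpq)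
  · rw [key hx p q hb, key hy p q hb]

theorem Rep.inv {I J : Finset (Fin n)} {π : Equiv.Perm ℕ} {x : Equiv.Perm (Fin (n + 1))}
    (h : Rep I J π x) : Rep J I π⁻¹ x⁻¹ := by
  have hb : ∀ p, blk J (x⁻¹ p) = π⁻¹ (blk I p) := by
    intro p
    rw [Equiv.Perm.eq_inv_iff_eq, ← h.blk_eq, ← Equiv.Perm.mul_apply, mul_inv_cancel,
      Equiv.Perm.one_apply]
  refine ⟨hb, fun s hs => ?_⟩
  by_contra! hlt
  have h1 := lt_of_le_of_ne hlt (x⁻¹.injective.ne Fin.castSucc_lt_succ.ne')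
  have h2 := h.inc.lt (by rw [hb, hb, blk_succ_of_mem hs]) h1
  simp only [← Equiv.Perm.mul_apply, mul_inv_cancel, Equiv.Perm.one_apply] at h2
  exact absurd h2 Fin.castSucc_lt_succ.not_gt

/-- A letter strictly between `x t` and `x (t + 1)` would lie in the same block of `I`, and its
preimage would lie strictly between the neighbours `t` and `t + 1`, because `x⁻¹` increases on
blocks of `I`. So neighbours go to neighbours. -/
theorem Rep.exists_apply {I J : Finset (Fin n)} {π : Equiv.Perm ℕ} {x : Equiv.Perm (Fin (n + 1))}
    (h : Rep I J π x) {t : Fin n} (ht : t ∈ J) :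
    ∃ s ∈ I, x t.castSucc = s.castSucc ∧ x t.succ = s.succ := by
  have h1 := h.inc t ht
  obtain ⟨s, hs⟩ := Fin.exists_castSucc_eq.2 (h1.trans_le (Fin.le_last _)).ne
  have hb : blk I (x t.succ) = blk I (x t.castSucc) := by
    rw [h.blk_eq_blk, blk_succ_of_mem ht]
  have h2 : s.succ ≤ x t.succ := Fin.castSucc_lt_iff_succ_le.1 (hs ▸ h1)
  have h3 : blk I s.succ = blk I s.castSucc := by
    refine le_antisymm ?_ (blk_mono I Fin.castSucc_lt_succ.le)
    rw [hs, ← hb]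
    exact blk_mono I h2
  have hsI := blk_succ_eq_iff.1 h3
  refine ⟨s, hsI, hs.symm, le_antisymm ?_ h2⟩
  by_contra! h4
  have h5 := h.inv.inc s hsI
  have h6 := h.inv.inc.lt (h3.trans (by rw [hs, ← hb])) h4
  rw [hs] at h5
  simp only [← Equiv.Perm.mul_apply, inv_mul_cancel, Equiv.Perm.one_apply] at h5 h6
  exact absurd (Fin.castSucc_lt_iff_succ_le.1 h5) h6.not_ge

theorem Rep.exists_conj {I J : Finset (Fin n)} {π : Equiv.Perm ℕ} {x : Equiv.Perm (Fin (n + 1))}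
    (h : Rep I J π x) {t : Fin n} (ht : t ∈ J) :
    ∃ s ∈ I, simple s = x * simple t * x⁻¹ := by
  obtain ⟨s, hs, h1, h2⟩ := h.exists_apply ht
  exact ⟨s, hs, by rw [conj_simple, h1, h2]; rfl⟩

theorem Rep.exists_conj' {I J : Finset (Fin n)} {π : Equiv.Perm ℕ} {x : Equiv.Perm (Fin (n + 1))}
    (h : Rep I J π x) {s : Fin n} (hs : s ∈ I) :
    ∃ t ∈ J, simple t = x⁻¹ * simple s * x := by
  obtain ⟨t, ht, h1⟩ := h.inv.exists_conj hs
  exact ⟨t, ht, by rw [h1, inv_inv]⟩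

theorem Rep.subset_of_perm {I I' J : Finset (Fin n)} {π π' : Equiv.Perm ℕ}
    {x : Equiv.Perm (Fin (n + 1))} (h : Rep I J π x) (h' : Rep I' J π' x) : I ⊆ I' := by
  intro s hs
  obtain ⟨t, ht, h1⟩ := h.exists_conj' hs
  obtain ⟨s', hs', h2⟩ := h'.exists_conj ht
  have : simple s' = simple s := by rw [h2, h1]; group
  rwa [← simple_injective this]

/-- `I` is recovered as `x J x⁻¹`. This is what forces two atomic words with the same permutation
and the same right end to have the same left end. -/
theorem Rep.left_eq {I I' J : Finset (Fin n)} {π : Equiv.Perm ℕ}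
    {x x' : Equiv.Perm (Fin (n + 1))} (h : Rep I J π x) (h' : Rep I' J π x') : I = I' := by
  obtain rfl := h.perm_eq h'
  exact (h.subset_of_perm h').antisymm (h'.subset_of_perm h)

theorem conj_mem_parabolic {I J : Finset (Fin n)} {x : Equiv.Perm (Fin (n + 1))}
    (h : ∀ s ∈ I, x⁻¹ * simple s * x ∈ parabolic J) {a : Equiv.Perm (Fin (n + 1))}
    (ha : a ∈ parabolic I) : x⁻¹ * a * x ∈ parabolic J := by
  induction ha using Subgroup.closure_induction with
  | mem a ha =>
    obtain ⟨s, hs, rfl⟩ := ha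
    exact h s hs
  | one => simp
  | mul a b _ _ ha hb =>
    have := mul_mem ha hb
    convert this using 1
    group
  | inv a _ ha =>
    have := inv_mem ha
    convert this using 1
    group

/-- If `x⁻¹ W_I x ⊆ W_J`, then every left factor can be moved across `x`, and the double coset
collapses to `x W_J`. -/
theorem mem_doubleCoset_iff {I J : Finset (Fin n)} {x z : Equiv.Perm (Fin (n + 1))}
    (h : ∀ s ∈ I, x⁻¹ * simple s * x ∈ parabolic J) :
    z ∈ DoubleCoset.doubleCoset x (parabolic I) (parabolic J) ↔ x⁻¹ * z ∈ parabolic J := by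
  rw [DoubleCoset.mem_doubleCoset]
  constructor
  · rintro ⟨a, ha, b, hb, rfl⟩
    have := mul_mem (conj_mem_parabolic h ha) hb
    convert this using 1
    group
  · intro hz
    exact ⟨1, one_mem _, _, hz, by group⟩

theorem Rep.mem_iff {I J : Finset (Fin n)} {π : Equiv.Perm ℕ} {x z : Equiv.Perm (Fin (n + 1))}
    (h : Rep I J π x) :
    z ∈ DoubleCoset.doubleCoset x (parabolic I) (parabolic J) ↔ x⁻¹ * z ∈ parabolic J := by
  refine mem_doubleCoset_iff fun s hs => ?_
  obtain ⟨t, ht, h1⟩ := h.exists_conj' hs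
  rw [← h1]
  exact simple_mem_parabolic ht

theorem IncOn.length_mul {J : Finset (Fin n)} {x b : Equiv.Perm (Fin (n + 1))}
    (h : IncOn J x) (hb : b ∈ parabolic J) : length (x * b) = length x + length b := by
  refine length_mul_of fun p q hpq hv => h.lt ?_ hv
  refine le_antisymm (blk_mono J hv.le) ?_
  rw [blk_apply hb, blk_apply hb]
  exact blk_mono J hpq.le

theorem Rep.isMinElt {I J : Finset (Fin n)} {π : Equiv.Perm ℕ} {x : Equiv.Perm (Fin (n + 1))}
    (h : Rep I J π x) :
    IsMinElt (DoubleCoset.doubleCoset x (parabolic I) (parabolic J)) x := by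
  refine ⟨DoubleCoset.mem_doubleCoset_self _ _ _, fun y hy => ?_⟩
  rw [h.mem_iff] at hy
  have := h.inc.length_mul hy
  rw [mul_inv_cancel_left] at this
  omega

theorem Rep.isMaxElt {I J : Finset (Fin n)} {π : Equiv.Perm ℕ} {x : Equiv.Perm (Fin (n + 1))}
    (h : Rep I J π x) :
    IsMaxElt (DoubleCoset.doubleCoset x (parabolic I) (parabolic J)) (x * longest J) := by
  refine ⟨?_, fun y hy => ?_⟩
  · rw [h.mem_iff, inv_mul_cancel_left]
    exact longest_mem J
  · rw [h.mem_iff] at hy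
    have h1 := h.inc.length_mul hy
    have h2 := length_le_longest hy
    rw [mul_inv_cancel_left] at h1
    rw [h.inc.length_mul (longest_mem J)]
    omega

/-- Maximal elements are unique here: lengths add in `x W_J`, so `x⁻¹ z` has maximal length in
`W_J`. Hence the set `p` alone determines its representative `x`. -/
theorem Rep.eq_of_isMaxElt {I J : Finset (Fin n)} {π : Equiv.Perm ℕ}
    {x z : Equiv.Perm (Fin (n + 1))} (h : Rep I J π x)
    (hz : IsMaxElt (DoubleCoset.doubleCoset x (parabolic I) (parabolic J)) z) :
    z = x * longest J := by
  have hm := h.mem_iff.1 hz.1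
  have : x⁻¹ * z = longest J := by
    refine eq_longest (blk_apply hm) (decOn_of_max hm fun v hv => ?_)
    have h1 := hz.2 (x * v) (by rwa [h.mem_iff, inv_mul_cancel_left])
    have h2 := h.inc.length_mul hm
    rw [mul_inv_cancel_left] at h2
    rw [h.inc.length_mul hv] at h1
    omega
  rw [← this, mul_inv_cancel_left]

theorem Rep.leftRed_eq {I J : Finset (Fin n)} {π : Equiv.Perm ℕ} {x : Equiv.Perm (Fin (n + 1))}
    (h : Rep I J π x) : leftRed I J x = I := by
  classical
  refine Finset.filter_true_of_mem fun s hs => ?_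
  obtain ⟨t, ht, h1⟩ := h.exists_conj' hs
  exact ⟨t, ht, by rw [h1]; group⟩

theorem Rep.rightRed_eq {I J : Finset (Fin n)} {π : Equiv.Perm ℕ} {x : Equiv.Perm (Fin (n + 1))}
    (h : Rep I J π x) : rightRed I J x = J := by
  classical
  refine Finset.filter_true_of_mem fun t ht => ?_
  obtain ⟨s, hs, h1⟩ := h.exists_conj ht
  exact ⟨s, hs, by rw [h1]; group⟩

theorem Rep.isCore {I J : Finset (Fin n)} {π : Equiv.Perm ℕ} {x : Equiv.Perm (Fin (n + 1))}
    (h : Rep I J π x) :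
    IsCore I J (DoubleCoset.doubleCoset x (parabolic I) (parabolic J)) :=
  ⟨⟨x, rfl⟩, x, h.isMinElt, h.leftRed_eq, h.rightRed_eq⟩

/-! ### Minimal elements of double cosets -/

open scoped Classical in
/-- The number of inversions of `w` between different blocks, both of `J` and of `I`. -/
noncomputable def blockInversions (I J : Finset (Fin n)) (w : Equiv.Perm (Fin (n + 1))) : ℕ :=
  (Finset.univ.filter fun x : Fin (n + 1) × Fin (n + 1) =>
    blk J x.1 < blk J x.2 ∧ blk I (w x.2) < blk I (w x.1)).card

theorem blockInversions_le (I J : Finset (Fin n)) (w : Equiv.Perm (Fin (n + 1))) :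
    blockInversions I J w ≤ length w := by
  classical
  refine Finset.card_le_card fun x => ?_
  simp only [Finset.mem_filter, Finset.mem_univ, true_and]
  exact fun h => ⟨lt_of_blk_lt h.1, lt_of_blk_lt h.2⟩

/-- Factors from `W_I` and `W_J` move letters only inside blocks, so this count is constant on a
double coset. It bounds the length of every element from below. -/
theorem blockInversions_mul {I J : Finset (Fin n)} {a w b : Equiv.Perm (Fin (n + 1))}
    (ha : a ∈ parabolic I) (hb : b ∈ parabolic J) :
    blockInversions I J (a * w * b) = blockInversions I J w := by
  classical
  rw [blockInversions, blockInversions, Finset.card_filter, Finset.card_filter,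
    ← Equiv.sum_comp (Equiv.prodCongr b b)
      (fun x => if blk J x.1 < blk J x.2 ∧ blk I (w x.2) < blk I (w x.1) then 1 else 0)]
  refine Finset.sum_congr rfl fun ⟨p, q⟩ _ => ?_
  simp only [Equiv.Perm.mul_apply, blk_apply ha, Equiv.prodCongr_apply, Prod.map_apply,
    blk_apply hb]

theorem blockInversions_eq {I J : Finset (Fin n)} {x : Equiv.Perm (Fin (n + 1))}
    (hJ : IncOn J x) (hI : IncOn I x⁻¹) : blockInversions I J x = length x := by
  classical
  refine le_antisymm (blockInversions_le I J x) (Finset.card_le_card fun ⟨p, q⟩ => ?_)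
  simp only [Finset.mem_filter, Finset.mem_univ, true_and]
  rintro ⟨h1, h2⟩
  refine ⟨lt_of_le_of_ne (blk_mono J h1.le) fun hb => (hJ.lt hb h1).not_gt h2,
    lt_of_le_of_ne (blk_mono I h2.le) fun hb => ?_⟩
  have := hI.lt hb h2
  simp only [← Equiv.Perm.mul_apply, inv_mul_cancel, Equiv.Perm.one_apply] at this
  exact this.not_gt h1

/-- Under these hypotheses every inversion of `x` is between different blocks on both sides, so `x`
attains the lower bound given by `blockInversions`. This serves cosets that are not core, where
`Rep` is not available. -/
theorem isMinElt_of_incOn {I J : Finset (Fin n)} {x : Equiv.Perm (Fin (n + 1))}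
    (hJ : IncOn J x) (hI : IncOn I x⁻¹) :
    IsMinElt (DoubleCoset.doubleCoset x (parabolic I) (parabolic J)) x := by
  refine ⟨DoubleCoset.mem_doubleCoset_self _ _ _, fun y hy => ?_⟩
  obtain ⟨a, ha, b, hb, rfl⟩ := DoubleCoset.mem_doubleCoset.1 hy
  rw [← blockInversions_eq hJ hI, ← blockInversions_mul ha hb]
  exact blockInversions_le _ _ _

/-! ### Atoms -/

/-- `w_M` reverses each of its blocks, so neighbours go to neighbours in the opposite order; thus `t
= w_M s w_M`. -/
theorem exists_longest_apply {M : Finset (Fin n)} {s : Fin n} (hs : s ∈ M) :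
    ∃ t ∈ M, longest M s.succ = t.castSucc ∧ longest M s.castSucc = t.succ := by
  have h1 := longest_decOn M s hs
  obtain ⟨t, ht⟩ := Fin.exists_castSucc_eq.2 (h1.trans_le (Fin.le_last _)).ne
  have h2 : t.succ ≤ longest M s.castSucc := Fin.castSucc_lt_iff_succ_le.1 (ht ▸ h1)
  have hb : blk M (longest M s.castSucc) = blk M (longest M s.succ) := by
    rw [blk_longest, blk_longest, blk_succ_of_mem hs]
  have h3 : blk M t.succ = blk M t.castSucc := by
    refine le_antisymm ?_ (blk_mono M Fin.castSucc_lt_succ.le)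
    rw [ht, ← hb]
    exact blk_mono M h2
  have htM := blk_succ_eq_iff.1 h3
  refine ⟨t, htM, ht.symm, le_antisymm ?_ h2⟩
  by_contra! h4
  have h5 := longest_decOn M t htM
  have h6 := (longest_lt_longest_iff (hb.trans (ht ▸ h3.symm))).2 h4
  rw [ht, longest_apply_longest] at h5
  rw [longest_apply_longest] at h6
  exact absurd (Fin.castSucc_lt_iff_succ_le.1 h6) h5.not_ge

/-- `[I, M, K]` is the expression of the atomic coset `a_i^K`, with `M = K + s` and `I = M - t`. -/
structure AtomData (i : ℕ) (I M K : Finset (Fin n)) (s t : Fin n) : Prop where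
  cut : IsCut K i s
  eq_insert : M = insert s K
  mem : t ∈ M
  apply_succ : longest M s.succ = t.castSucc
  apply_castSucc : longest M s.castSucc = t.succ
  eq_erase : I = M.erase t

theorem isAtom_iff {i : ℕ} {I M K : Finset (Fin n)} :
    IsAtom i I M K ↔ ∃ s t, AtomData i I M K s t := by
  constructor
  · rintro ⟨s, t, hs, hc, rfl, ht, h, rfl⟩
    have hd := longest_decOn (insert s K) s (Finset.mem_insert_self _ _)
    -- As `w_M` is an involution, `w_M s w_M` is a conjugate, namely the transposition of the images
    -- of the two letters moved by `s`.
    rw [← longest_inv (insert s K), longest_inv, ← longest_inv (insert s K)] at h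
    nth_rewrite 1 [longest_inv] at h
    rw [conj_simple] at h
    rcases swap_eq_simple h with h' | h'
    · rw [h'.1, h'.2] at hd
      exact absurd hd Fin.castSucc_lt_succ.not_gt
    · exact ⟨s, t, isCut_iff_card.2 ⟨hs, hc⟩, rfl, ht, h'.2, h'.1, rfl⟩
  · rintro ⟨s, t, h⟩
    obtain ⟨h1, h2⟩ := isCut_iff_card.1 h.cut
    refine ⟨s, t, h1, h2, h.eq_insert, h.mem, ?_, h.eq_erase⟩
    conv_rhs => rw [← longest_inv M]
    nth_rewrite 1 [longest_inv]
    rw [conj_simple, h.apply_succ, h.apply_castSucc, Equiv.swap_comm]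
    rfl

theorem exists_atomData {K : Finset (Fin n)} {i : ℕ} {s : Fin n} (h : IsCut K i s) :
    ∃ t, AtomData i ((insert s K).erase t) (insert s K) K s t := by
  obtain ⟨t, ht, h1, h2⟩ := exists_longest_apply (Finset.mem_insert_self s K)
  exact ⟨t, h, rfl, ht, h1, h2, rfl⟩

namespace AtomData

variable {i : ℕ} {I M K : Finset (Fin n)} {s t : Fin n}

theorem right_subset (h : AtomData i I M K s t) : K ⊆ M := by
  rw [h.eq_insert]; exact Finset.subset_insert _ _

theorem left_subset (h : AtomData i I M K s t) : I ⊆ M := by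
  rw [h.eq_erase]; exact Finset.erase_subset _ _

theorem mem_right (h : AtomData i I M K s t) : s ∈ M := by
  rw [h.eq_insert]; exact Finset.mem_insert_self _ _

theorem notMem_left (h : AtomData i I M K s t) : t ∉ I := by
  rw [h.eq_erase]; exact Finset.notMem_erase _ _

theorem insert_left (h : AtomData i I M K s t) : insert t I = M := by
  rw [h.eq_erase, Finset.insert_erase h.mem]

theorem erase_right (h : AtomData i I M K s t) : M.erase s = K := by
  rw [h.eq_insert, Finset.erase_insert h.cut.1]

theorem blk_right (h : AtomData i I M K s t) (p : Fin (n + 1)) :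
    blk K p = blk M p + if s.castSucc < p then 1 else 0 := by
  rw [h.eq_insert]; exact blk_insert h.cut.1 p

theorem blk_left (h : AtomData i I M K s t) (p : Fin (n + 1)) :
    blk I p = blk M p + if t.castSucc < p then 1 else 0 := by
  rw [← h.insert_left]; exact blk_insert h.notMem_left p

theorem blk_mid (h : AtomData i I M K s t) : blk M s.castSucc = i := by
  have := h.blk_right s.castSucc
  rw [h.cut.2] at this
  simpa using this.symm

theorem blk_mid' (h : AtomData i I M K s t) : blk M t.castSucc = i := by
  rw [← h.apply_succ, blk_longest, blk_succ_of_mem h.mem_right, h.blk_mid]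

theorem cut_left (h : AtomData i I M K s t) : IsCut I i t :=
  ⟨h.notMem_left, by rw [h.blk_left, h.blk_mid']; simp⟩

/-- Passing from `K` to `I` trades `s` for `t`, which lie in the same block of `M`. An `r ∉ M` is on
the same side of both, so its index does not change. -/
theorem isCut_of_notMem (h : AtomData i I M K s t) {r : Fin n} (hr : r ∉ M) {j : ℕ}
    (hc : IsCut K j r) : IsCut I j r := by
  refine ⟨fun h' => hr (h.left_subset h'), ?_⟩
  rw [← hc.2, h.blk_left, h.blk_right]
  have h1 : s.castSucc < r.castSucc ↔ t.castSucc < r.castSucc := by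
    have hM : IsCut M (blk M r.castSucc) r := ⟨hr, rfl⟩
    have hs : s.castSucc ≠ r.castSucc := fun he =>
      hr (Fin.castSucc_injective _ he ▸ h.mem_right)
    have ht : t.castSucc ≠ r.castSucc := fun he => hr (Fin.castSucc_injective _ he ▸ h.mem)
    rw [← hs.le_iff_lt, ← ht.le_iff_lt, hM.le_iff, hM.le_iff, h.blk_mid, h.blk_mid']
  simp [h1]

theorem card_compl_eq (h : AtomData i I M K s t) : Iᶜ.card = Kᶜ.card := by
  have h1 : M.card = K.card + 1 := by
    rw [h.eq_insert, Finset.card_insert_of_notMem h.cut.1]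
  have h2 : I.card = M.card - 1 := by
    rw [h.eq_erase, Finset.card_erase_of_mem h.mem]
  rw [Finset.card_compl, Finset.card_compl]
  omega

/-- `w_K` reverses each block of `K`, then `w_M` reverses each block of `M`. The two reversals
cancel except in block `i` of `M`, which consists of blocks `i` and `i + 1` of `K`: these trade
places, and the order inside each is restored. -/
theorem rep (h : AtomData i I M K s t) :
    Rep I K (Equiv.swap i (i + 1)) (longest M * longest K) := by
  have hKM : ∀ {p q}, blk K p = blk K q → blk M p = blk M q := blk_le_of_subset h.right_subset
  have hy : ∀ p, blk M (longest M (longest K p)) = blk M p := fun p => by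
    rw [blk_longest, hKM (blk_longest K p)]
  refine ⟨fun p => ?_, fun r hr => ?_⟩
  · rw [Equiv.Perm.mul_apply, h.blk_left, hy, h.blk_right]
    rcases lt_trichotomy (blk M p) i with hb | hb | hb
    · rw [if_neg, if_neg, add_zero, Equiv.swap_apply_of_ne_of_ne hb.ne (by omega)]
      · rw [not_lt]
        exact (lt_of_blk_lt (by rwa [h.blk_mid])).le
      · rw [not_lt]
        exact (lt_of_blk_lt (J := M) (by rwa [h.blk_mid', hy])).le
    -- Inside block `i` of `M`, the image lies to the right of the cut `t` exactly when `p` lies to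
    -- the left of the cut `s`.
    · have h1 : t.castSucc < longest M (longest K p) ↔ ¬ s.castSucc < p := by
        rw [← h.apply_succ, longest_lt_longest_iff, h.cut.lt_iff, ← not_le,
          ← Fin.castSucc_lt_iff_succ_le, not_lt, h.cut.le_iff, blk_longest, not_lt]
        rw [hKM (blk_longest K p), blk_succ_of_mem h.mem_right, h.blk_mid, hb]
      by_cases h2 : s.castSucc < p <;> simp [h1, h2, hb]
    · rw [if_pos, if_pos, Equiv.swap_apply_of_ne_of_ne (by omega) (by omega)]
      · exact lt_of_blk_lt (by rwa [h.blk_mid])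
      · exact lt_of_blk_lt (J := M) (by rwa [h.blk_mid', hy])
  · rw [Equiv.Perm.mul_apply, Equiv.Perm.mul_apply]
    refine (longest_lt_longest_iff (hKM ?_)).2 (longest_decOn K r hr)
    rw [blk_longest, blk_longest, blk_succ_of_mem hr]

end AtomData

/-! ### Telescoping of products and lengths along expressions. -/

theorem exprProd_of_subset {I M : Finset (Fin n)} (h : I ⊆ M) (E : List (Finset (Fin n))) :
    exprProd (I :: M :: E) = exprProd (M :: E) := by
  rw [exprProd, Finset.union_eq_right.2 h, mul_inv_cancel, one_mul]

theorem exprProd_of_superset {K M : Finset (Fin n)} (h : K ⊆ M) (E : List (Finset (Fin n))) :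
    exprProd (M :: K :: E) = longest M * longest K * exprProd (K :: E) := by
  rw [exprProd, Finset.union_eq_left.2 h, longest_inv]

theorem exprLength_of_subset {I M : Finset (Fin n)} (h : I ⊆ M) (E : List (Finset (Fin n))) :
    exprLength (I :: M :: E) = exprLength (M :: E) := by
  rw [exprLength, Finset.union_eq_right.2 h]
  ring

theorem exprLength_of_superset {K M : Finset (Fin n)} (h : K ⊆ M) (E : List (Finset (Fin n))) :
    exprLength (M :: K :: E) = length (longest M) - length (longest K) + exprLength (K :: E) := by
  rw [exprLength, Finset.union_eq_left.2 h]

namespace AtomData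

variable {i : ℕ} {I M K : Finset (Fin n)} {s t : Fin n}

theorem exprProd_eq (h : AtomData i I M K s t) (E : List (Finset (Fin n))) :
    exprProd (I :: M :: K :: E) = longest M * longest K * exprProd (K :: E) := by
  rw [exprProd_of_subset h.left_subset, exprProd_of_superset h.right_subset]

theorem exprLength_eq (h : AtomData i I M K s t) (E : List (Finset (Fin n))) :
    exprLength (I :: M :: K :: E) =
      length (longest M * longest K) + exprLength (K :: E) := by
  -- Writing `w_M = (w_M w_K) w_K` with lengths adding gives `ℓ(M) - ℓ(K) = ℓ(w_M w_K)`.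
  have := h.rep.inc.length_mul (longest_mem K)
  rw [mul_assoc, longest_mul_self, mul_one] at this
  rw [exprLength_of_subset h.left_subset, exprLength_of_superset h.right_subset, this]
  push_cast
  ring

theorem adjacent_left (h : AtomData i I M K s t) : Adjacent I M :=
  Or.inl ⟨t, h.notMem_left, h.insert_left.symm⟩

theorem adjacent_right (h : AtomData i I M K s t) : Adjacent M K :=
  Or.inr ⟨s, h.mem_right, h.erase_right.symm⟩

theorem walk_eq (h : AtomData i I M K s t) (l : List (Step n)) :
    walk I (Step.add t :: Step.sub s :: l) = I :: M :: walk K l := by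
  rw [walk, walk, h.insert_left, h.erase_right]

theorem isReducedExpr (h : AtomData i I M K s t) :
    IsReducedExpr I K (DoubleCoset.doubleCoset (longest M * longest K) (parabolic I)
      (parabolic K)) [I, M, K] := by
  refine ⟨⟨_, rfl⟩, ⟨rfl, rfl, ?_⟩, ?_, ?_⟩
  · simp [h.adjacent_left, h.adjacent_right]
  · rw [h.exprProd_eq, exprProd]
    exact h.rep.isMaxElt
  · rw [h.exprProd_eq, h.exprLength_eq, exprProd, exprLength, h.rep.inc.length_mul (longest_mem K)]
    push_cast
    rfl

theorem isAtomic (h : AtomData i I M K s t) :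
    IsAtomic I K (DoubleCoset.doubleCoset (longest M * longest K) (parabolic I)
      (parabolic K)) :=
  ⟨h.rep.isCore, t, s, by rw [h.walk_eq]; exact h.isReducedExpr⟩

end AtomData

/-! ### Every atomic coset is some `a_i^J`. -/

theorem Adjacent.ne {I J : Finset (Fin n)} (h : Adjacent I J) : I ≠ J := by
  rintro rfl
  rcases h with ⟨s, hs, h⟩ | ⟨s, hs, h⟩
  · exact hs (h ▸ Finset.mem_insert_self _ _)
  · rw [h] at hs
    exact Finset.notMem_erase _ _ hs

/-- The cut `t` separates two neighbouring letters into different blocks of `M \ t`, and `w_M`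
reverses their order, so `w_M` cannot preserve these blocks. -/
theorem longest_notMem_parabolic_erase {M : Finset (Fin n)} {t : Fin n} (ht : t ∈ M) :
    longest M ∉ parabolic (M.erase t) := by
  intro h
  have h1 := blk_mono (M.erase t) (longest_decOn M t ht).le
  rw [blk_apply h, blk_apply h, blk_succ_of_notMem (Finset.notMem_erase _ _)] at h1
  omega

/-- Being core matches the elements of `I` with those of `J`, so `I` and `J` have equal size and
`[I, M, J]` goes up then down, or down then up. In the first case the removed reflection is shown to
be the conjugate by `w_M` of the added one; the second is excluded. -/
theorem IsAtomic.exists_atomData {I M J : Finset (Fin n)} {q : Set (Equiv.Perm (Fin (n + 1)))}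
    (hq : IsAtomic I J q) (hr : IsReducedExpr I J q [I, M, J]) :
    ∃ i s t, AtomData i I M J s t := by
  obtain ⟨⟨⟨w, hw⟩, x, hx, hl, hr'⟩, s', t', -, ⟨-, hJ, hadj'⟩, hmax', -⟩ := hq
  obtain rfl : q = DoubleCoset.doubleCoset x (parabolic I) (parabolic J) := by
    rw [hw] at hx ⊢
    exact (DoubleCoset.doubleCoset_eq_of_mem hx.1).symm
  have hl' : ∀ s ∈ I, ∃ t ∈ J, simple s = x * simple t * x⁻¹ := fun s hs => by
    classical
    rw [← hl] at hs
    exact (Finset.mem_filter.1 hs).2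
  have hr'' : ∀ t ∈ J, ∃ s ∈ I, simple t = x⁻¹ * simple s * x := fun s hs => by
    classical
    rw [← hr'] at hs
    exact (Finset.mem_filter.1 hs).2
  have hcard : I.card = J.card := by
    choose! f hf using hl'
    choose! g hg using hr''
    refine le_antisymm (Finset.card_le_card_of_injOn f (fun s hs => (hf s hs).1) ?_)
      (Finset.card_le_card_of_injOn g (fun s hs => (hg s hs).1) ?_)
    · intro a ha b hb hab
      apply simple_injective
      rw [(hf a ha).2, (hf b hb).2, hab]
    · intro a ha b hb hab
      apply simple_injective
      rw [(hg a ha).2, (hg b hb).2, hab]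
  have hmem : ∀ z, z ∈ DoubleCoset.doubleCoset x (parabolic I) (parabolic J) ↔
      x⁻¹ * z ∈ parabolic J := fun z => by
    refine mem_doubleCoset_iff fun s hs => ?_
    obtain ⟨t, ht, h⟩ := hl' s hs
    convert simple_mem_parabolic ht using 1
    rw [h]
    group
  obtain ⟨-, ⟨-, -, hadj⟩, hmax, -⟩ := hr
  simp only [List.isChain_cons_cons, List.isChain_singleton, and_true] at hadj
  obtain ⟨h1 | h1, h2 | h2⟩ := hadj
  · obtain ⟨s, hs, rfl⟩ := h1
    obtain ⟨t, ht, rfl⟩ := h2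
    rw [Finset.card_insert_of_notMem ht, Finset.card_insert_of_notMem hs] at hcard
    omega
  · obtain ⟨s, hs, rfl⟩ := h1
    obtain ⟨t, ht, rfl⟩ := h2
    obtain ⟨u, hu, h3, h4⟩ := exists_longest_apply ht
    have hus : u = s := by
      by_contra hne
      have huI : u ∈ I := (Finset.mem_insert.1 hu).resolve_left hne
      have hw := hmax.1
      rw [exprProd_of_subset (Finset.subset_insert _ _),
        exprProd_of_superset (Finset.erase_subset _ _), exprProd, mul_assoc, longest_mul_self,
        mul_one] at hw
      -- If `u = w_M t w_M` were in `I`, then `u w_M = w_M t` would lie in the coset along with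
      -- `w_M`. As the coset is `x W_J`, this puts `t` in `W_J`, although `t` was removed.
      have hw' : simple u * longest (insert s I) ∈
          DoubleCoset.doubleCoset x (parabolic I) (parabolic ((insert s I).erase t)) := by
        obtain ⟨a, ha, b, hb, h5⟩ := DoubleCoset.mem_doubleCoset.1 hw
        rw [h5]
        exact DoubleCoset.mem_doubleCoset.2
          ⟨simple u * a, mul_mem (simple_mem_parabolic huI) ha, b, hb, by group⟩
      rw [hmem] at hw hw'
      have h6 := mul_mem (inv_mem hw) hw'
      have h7 : (x⁻¹ * longest (insert s I))⁻¹ * (x⁻¹ * (simple u * longest (insert s I)))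
          = simple t := by
        have : simple u = longest (insert s I) * simple t * (longest (insert s I))⁻¹ := by
          rw [conj_simple, h3, h4, Equiv.swap_comm]
          rfl
        rw [this]
        group
      rw [h7, simple_mem_parabolic_iff] at h6
      exact Finset.notMem_erase _ _ h6
    subst hus
    refine ⟨_, t, u, ⟨Finset.notMem_erase _ _, rfl⟩, (Finset.insert_erase ht).symm, hu, h3, h4, ?_⟩
    rw [Finset.erase_insert hs]
  · exfalso
    obtain ⟨s, hs, rfl⟩ := h1
    obtain ⟨t, ht, rfl⟩ := h2
    -- A down-up product lies in `W_I W_J`, so the coset is `W_J` itself. Atomicity also provides an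
    -- up-down expression, which puts the longest element of `I + s'` in this coset, contradicting
    -- `longest_notMem_parabolic_erase`.
    have hone : (1 : Equiv.Perm (Fin (n + 1))) ∈
        DoubleCoset.doubleCoset x (parabolic I) (parabolic (insert t (I.erase s))) := by
      obtain ⟨a, ha, b, hb, h5⟩ := DoubleCoset.mem_doubleCoset.1 hmax.1
      rw [exprProd_of_superset (Finset.erase_subset _ _),
        exprProd_of_subset (Finset.subset_insert _ _), exprProd] at h5
      have h6 := parabolic_mono (Finset.erase_subset s I) (longest_mem (I.erase s))
      refine DoubleCoset.mem_doubleCoset.2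
        ⟨(longest I * longest (I.erase s))⁻¹ * a,
          mul_mem (inv_mem (mul_mem (longest_mem I) h6)) ha,
          b * (longest (insert t (I.erase s)))⁻¹, mul_mem hb (inv_mem (longest_mem _)), ?_⟩
      have : x = a⁻¹ * (longest I * longest (I.erase s) * longest (insert t (I.erase s))) * b⁻¹ := by
        rw [h5]
        group
      rw [this]
      group
    simp only [walk, List.isChain_cons_cons, List.isChain_singleton, and_true] at hadj'
    simp only [walk, List.getLast?_cons_cons, List.getLast?_singleton, Option.some.injEq] at hJ
    have ht' : t' ∈ insert s' I := by
      by_contra h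
      exact hadj'.2.ne (Finset.erase_eq_of_notMem h).symm
    have hw := hmax'.1
    rw [walk, walk, walk, exprProd_of_subset (Finset.subset_insert _ _),
        exprProd_of_superset (Finset.erase_subset _ _), exprProd, mul_assoc, longest_mul_self,
        mul_one] at hw
    rw [hmem] at hw hone
    have := mul_mem (inv_mem hone) hw
    rw [← hJ] at this
    refine longest_notMem_parabolic_erase ht' ?_
    convert this using 1
    group
  · obtain ⟨s, hs, rfl⟩ := h1
    obtain ⟨t, ht, rfl⟩ := h2
    rw [Finset.card_erase_of_mem ht, Finset.card_erase_of_mem hs] at hcard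
    have := Finset.card_pos.2 ⟨_, hs⟩
    have := Finset.card_pos.2 ⟨_, ht⟩
    rw [Finset.card_erase_of_mem hs] at this
    omega

/-! ### Words in the adjacent transpositions of `ℕ` -/

/-- The product of the adjacent transpositions `(i i+1)` for the letters `i` of a word. -/
def wordPerm : List ℕ → Equiv.Perm ℕ
  | [] => 1
  | i :: u => Equiv.swap i (i + 1) * wordPerm u

/-- A word is reduced if each letter adds an inversion. -/
def RedWord : List ℕ → Prop
  | [] => True
  | i :: u => (wordPerm u)⁻¹ i < (wordPerm u)⁻¹ (i + 1) ∧ RedWord u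

/-- One braid move in a word. -/
inductive BraidStep : List ℕ → List ℕ → Prop
  | braid (i : ℕ) (u : List ℕ) : BraidStep (i :: (i + 1) :: i :: u) ((i + 1) :: i :: (i + 1) :: u)
  | braid' (i : ℕ) (u : List ℕ) : BraidStep ((i + 1) :: i :: (i + 1) :: u) (i :: (i + 1) :: i :: u)
  | comm (i j : ℕ) (h : i + 1 < j ∨ j + 1 < i) (u : List ℕ) : BraidStep (i :: j :: u) (j :: i :: u)
  | cons (i : ℕ) {u v : List ℕ} (h : BraidStep u v) : BraidStep (i :: u) (i :: v)

theorem wordPerm_cons_inv (i : ℕ) (u : List ℕ) (m : ℕ) :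
    (wordPerm (i :: u))⁻¹ m = (wordPerm u)⁻¹ (Equiv.swap i (i + 1) m) := by
  rw [wordPerm, mul_inv_rev, Equiv.swap_inv, Equiv.Perm.mul_apply]

theorem swap_apply_lower (i : ℕ) : Equiv.swap i (i + 1) i = i + 1 := Equiv.swap_apply_left _ _

theorem swap_apply_upper (i : ℕ) : Equiv.swap i (i + 1) (i + 1) = i := Equiv.swap_apply_right _ _

theorem swap_apply_other {i m : ℕ} (h1 : m ≠ i) (h2 : m ≠ i + 1) : Equiv.swap i (i + 1) m = m :=
  Equiv.swap_apply_of_ne_of_ne h1 h2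

theorem swap_commute {i j : ℕ} (h : i + 1 < j ∨ j + 1 < i) :
    Equiv.swap i (i + 1) * Equiv.swap j (j + 1) = Equiv.swap j (j + 1) * Equiv.swap i (i + 1) := by
  ext m
  simp only [Equiv.Perm.mul_apply, Equiv.swap_apply_def]
  split_ifs <;> omega

theorem swap_braid (i : ℕ) :
    Equiv.swap i (i + 1) * (Equiv.swap (i + 1) (i + 1 + 1) * Equiv.swap i (i + 1)) =
    Equiv.swap (i + 1) (i + 1 + 1) * (Equiv.swap i (i + 1) * Equiv.swap (i + 1) (i + 1 + 1)) := by
  ext m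
  simp only [Equiv.Perm.mul_apply, Equiv.swap_apply_def]
  split_ifs <;> omega

theorem BraidStep.wordPerm_eq {u v : List ℕ} (h : BraidStep u v) : wordPerm u = wordPerm v := by
  induction h with
  | braid i u =>
    simp only [wordPerm]
    simpa only [mul_assoc] using congrArg (· * wordPerm u) (swap_braid i)
  | braid' i u =>
    simp only [wordPerm]
    simpa only [mul_assoc] using congrArg (· * wordPerm u) (swap_braid i).symm
  | comm i j h u => simp only [wordPerm, ← mul_assoc, swap_commute h]
  | cons i h ih => simp only [wordPerm, ih]

/-- For a braid, both sides require the values of `(wordPerm u)⁻¹` at `i`, `i + 1`, `i + 2` to be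
pairwise increasing; for a commutation, each letter imposes the same inequality in either order. -/
theorem BraidStep.redWord {u v : List ℕ} (h : BraidStep u v) (hu : RedWord u) : RedWord v := by
  induction h with
  | braid i u =>
    simp only [RedWord, wordPerm_cons_inv, swap_apply_lower, swap_apply_upper,
      swap_apply_other (show i ≠ i + 1 by omega) (show i ≠ i + 1 + 1 by omega),
      swap_apply_other (show i + 1 + 1 ≠ i by omega) (show i + 1 + 1 ≠ i + 1 by omega)] at hu ⊢
    tauto
  | braid' i u =>
    simp only [RedWord, wordPerm_cons_inv, swap_apply_lower, swap_apply_upper,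
      swap_apply_other (show i ≠ i + 1 by omega) (show i ≠ i + 1 + 1 by omega),
      swap_apply_other (show i + 1 + 1 ≠ i by omega) (show i + 1 + 1 ≠ i + 1 by omega)] at hu ⊢
    tauto
  | comm i j h u =>
    simp only [RedWord, wordPerm_cons_inv,
      swap_apply_other (show i ≠ j by omega) (show i ≠ j + 1 by omega),
      swap_apply_other (show j ≠ i by omega) (show j ≠ i + 1 by omega),
      swap_apply_other (show i + 1 ≠ j by omega) (show i + 1 ≠ j + 1 by omega),
      swap_apply_other (show j + 1 ≠ i by omega) (show j + 1 ≠ i + 1 by omega)] at hu ⊢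
    tauto
  | cons i h ih =>
    simp only [RedWord, ← h.wordPerm_eq] at hu ⊢
    exact ⟨hu.1, ih hu.2⟩

/-- Equivalence of words under braid moves. -/
abbrev BraidEquiv : List ℕ → List ℕ → Prop := Relation.ReflTransGen BraidStep

theorem BraidEquiv.cons (i : ℕ) {u v : List ℕ} (h : BraidEquiv u v) :
    BraidEquiv (i :: u) (i :: v) :=
  Relation.ReflTransGen.lift (i :: ·) (fun _ _ h => BraidStep.cons i h) _ _ h

theorem BraidEquiv.wordPerm_eq {u v : List ℕ} (h : BraidEquiv u v) : wordPerm u = wordPerm v := by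
  induction h with
  | refl => rfl
  | tail _ h ih => rw [ih, h.wordPerm_eq]

theorem BraidEquiv.redWord {u v : List ℕ} (h : BraidEquiv u v) (hu : RedWord u) : RedWord v := by
  induction h with
  | refl => exact hu
  | tail _ h ih => exact h.redWord ih

theorem BraidEquiv.length_eq {u v : List ℕ} (h : BraidEquiv u v) : u.length = v.length := by
  have key : ∀ {u v}, BraidStep u v → u.length = v.length := by
    intro u v h
    induction h with
    | cons i h ih => simp [ih]
    | _ => rfl
  induction h with
  | refl => rfl
  | tail _ h ih => rw [ih, key h]

/-- The exchange step of Matsumoto's theorem: a left descent `i` can be moved to the front. With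
first letter `j`, a distant `i` is brought to the front of the tail and commuted past `j`. If `|i -
j| = 1`, the three inequalities show that the tail has descent `i`, and what remains has descent
`j`; the word then begins `j i j`, and one braid puts `i` in front. -/
theorem exists_braidEquiv_cons (k : ℕ) : ∀ (u : List ℕ) (i : ℕ), u.length = k → RedWord u →
    (wordPerm u)⁻¹ (i + 1) < (wordPerm u)⁻¹ i → ∃ v, BraidEquiv u (i :: v) := by
  induction k using Nat.strong_induction_on with
  | _ k ih =>
    intro u i hk hu hd
    match u with
    | [] => simp [wordPerm] at hd
    | j :: u =>
      obtain ⟨hj, hu'⟩ := hu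
      simp only [List.length_cons] at hk
      rw [wordPerm_cons_inv, wordPerm_cons_inv] at hd
      rcases eq_or_ne i j with rfl | hij
      · exact ⟨u, .refl⟩
      by_cases hc : i + 1 < j ∨ j + 1 < i
      · rw [swap_apply_other (by omega) (by omega), swap_apply_other (by omega) (by omega)] at hd
        obtain ⟨v, hv⟩ := ih u.length (by omega) u i rfl hu' hd
        exact ⟨j :: v, (hv.cons j).tail (.comm j i (by omega) v)⟩
      · rcases (show i = j + 1 ∨ j = i + 1 by omega) with rfl | rfl
        · rw [swap_apply_upper, swap_apply_other (by omega) (by omega)] at hd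
          obtain ⟨v, hv⟩ := ih u.length (by omega) u (j + 1) rfl hu' (hd.trans hj)
          have hl := hv.length_eq
          simp only [List.length_cons] at hl
          have hr := hv.redWord hu'
          rw [hv.wordPerm_eq, wordPerm_cons_inv, wordPerm_cons_inv, swap_apply_upper,
            swap_apply_other (by omega) (by omega)] at hd
          obtain ⟨v', hv'⟩ := ih v.length (by omega) v j rfl hr.2 hd
          exact ⟨j :: (j + 1) :: v', (BraidEquiv.cons j (hv.trans (hv'.cons _))).tail (.braid j v')⟩
        · rw [swap_apply_lower, swap_apply_other (by omega) (by omega)] at hd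
          obtain ⟨v, hv⟩ := ih u.length (by omega) u i rfl hu' (hj.trans hd)
          have hl := hv.length_eq
          simp only [List.length_cons] at hl
          have hr := hv.redWord hu'
          rw [hv.wordPerm_eq, wordPerm_cons_inv, wordPerm_cons_inv,
            swap_apply_other (by omega) (by omega), swap_apply_lower] at hd
          obtain ⟨v', hv'⟩ := ih v.length (by omega) v (i + 1) rfl hr.2 hd
          exact ⟨(i + 1) :: i :: v', (BraidEquiv.cons (i + 1) (hv.trans (hv'.cons _))).tail (.braid' i v')⟩

/-- Matsumoto's theorem for the symmetric group. -/
theorem braidEquiv_of_wordPerm_eq : ∀ {u v : List ℕ}, RedWord u → RedWord v →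
    wordPerm u = wordPerm v → BraidEquiv v u
  | [], v, _, hv, h => by
    match v with
    | [] => exact .refl
    | j :: v =>
      exfalso
      have h1 := wordPerm_cons_inv j v (j + 1)
      have h2 := wordPerm_cons_inv j v j
      rw [← h, swap_apply_upper] at h1
      rw [← h, swap_apply_lower] at h2
      have := hv.1
      rw [← h1, ← h2] at this
      simp [wordPerm] at this
  | i :: u, v, hu, hv, h => by
    obtain ⟨v', hv'⟩ := exists_braidEquiv_cons _ v i rfl hv (by
      rw [← h, wordPerm_cons_inv, wordPerm_cons_inv, swap_apply_upper, swap_apply_lower]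
      exact hu.1)
    have h1 : wordPerm u = wordPerm v' := by
      have := h.trans hv'.wordPerm_eq
      simpa only [wordPerm, mul_right_inj] using this
    exact hv'.trans ((braidEquiv_of_wordPerm_eq hu.2 (hv'.redWord hv).2 h1).cons i)

/-! ### Atomic expressions and words -/

theorem AtomData.isAtom {i : ℕ} {I M K : Finset (Fin n)} {s t : Fin n}
    (h : AtomData i I M K s t) : IsAtom i I M K :=
  isAtom_iff.2 ⟨s, t, h⟩

/-- The atom inverts only pairs between blocks `i` and `i + 1`. Such a pair is cancelled when `z`
has already brought block `i + 1` from the left of block `i`, that is, when `i` is a descent of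
`π⁻¹`. -/
theorem AtomData.cancel_eq_zero_iff {i : ℕ} {I M K J : Finset (Fin n)} {s t : Fin n}
    (h : AtomData i I M K s t) {π : Equiv.Perm ℕ} {z : Equiv.Perm (Fin (n + 1))}
    (hz : ∀ p, blk K (z p) = π (blk J p)) :
    cancel (longest M * longest K) z = 0 ↔ π⁻¹ i < π⁻¹ (i + 1) := by
  rw [AtomicCoset.cancel_eq_zero_iff]
  have hz' : ∀ p, blk J (z⁻¹ p) = π⁻¹ (blk K p) := fun p => by
    rw [Equiv.Perm.eq_inv_iff_eq, ← hz, ← Equiv.Perm.mul_apply, mul_inv_cancel,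
      Equiv.Perm.one_apply]
  constructor
  · intro hc
    by_contra! hle
    have hlt := lt_of_le_of_ne hle (π⁻¹.injective.ne (by omega))
    have h1 := hc (z⁻¹ s.succ) (z⁻¹ s.castSucc)
      (lt_of_blk_lt (J := J) (by rwa [hz', hz', h.cut.succ, h.cut.2]))
    rw [← Equiv.Perm.mul_apply z, ← Equiv.Perm.mul_apply z, mul_inv_cancel, Equiv.Perm.one_apply,
      Equiv.Perm.one_apply] at h1
    have h2 := blk_mono I (h1 Fin.castSucc_lt_succ).le
    rw [h.rep.blk_eq, h.rep.blk_eq, h.cut.succ, h.cut.2, swap_apply_lower, swap_apply_upper] at h2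
    omega
  · intro hlt p q hpq hv
    rcases (blk_mono K hv.le).eq_or_lt with hb | hb
    · exact h.rep.inc.lt hb hv
    · by_contra! hle
      have h2 := blk_mono I hle
      rw [h.rep.blk_eq, h.rep.blk_eq, Equiv.swap_apply_def, Equiv.swap_apply_def] at h2
      have h3 : blk K (z q) = i ∧ blk K (z p) = i + 1 := by
        split_ifs at h2 <;> omega
      rw [← h3.2, ← h3.1, hz, hz, ← Equiv.Perm.mul_apply, ← Equiv.Perm.mul_apply, inv_mul_cancel,
        Equiv.Perm.one_apply, Equiv.Perm.one_apply] at hlt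
      exact (lt_of_blk_lt hlt).not_gt hpq

/-- Each atom multiplies the representative by a block swap, and the length defect grows by twice
the number of cancelled inversions. The inequality is carried along because total defect zero must
force defect zero in the tail as well as no new cancellation. -/
theorem IsAtomWord.exists_rep {J I : Finset (Fin n)} {u : List ℕ} {T : List (Finset (Fin n))}
    (h : IsAtomWord J u (I :: T)) :
    ∃ x, Rep I J (wordPerm u) x ∧ exprProd (I :: T) = x * longest J ∧
      (length (exprProd (I :: T)) : ℤ) ≤ exprLength (I :: T) ∧
      ((length (exprProd (I :: T)) : ℤ) = exprLength (I :: T) ↔ RedWord u) := by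
  generalize hE : I :: T = E at h
  induction h generalizing I T with
  | nil =>
    obtain ⟨rfl, rfl⟩ := List.cons.inj hE
    exact ⟨1, Rep.one _, by simp [exprProd], by simp [exprProd, exprLength],
      by simp [exprProd, exprLength, RedWord]⟩
  | cons i u I' M K E h _ ih =>
    obtain ⟨rfl, rfl⟩ := List.cons.inj hE
    obtain ⟨x, hx, h1, h2, h3⟩ := ih rfl
    obtain ⟨s, t, h⟩ := isAtom_iff.1 h
    have hz : ∀ p, blk K (exprProd (K :: E) p) = wordPerm u (blk J p) := fun p => by
      rw [h1, Equiv.Perm.mul_apply, hx.blk_eq, blk_longest]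
    have h4 := length_add_length (longest M * longest K) (exprProd (K :: E))
    have h5 := h.cancel_eq_zero_iff hz
    rw [h.exprProd_eq, h.exprLength_eq]
    refine ⟨longest M * longest K * x, h.rep.mul hx, by rw [h1]; group, by omega, ?_⟩
    rw [RedWord, ← h3, ← h5]
    omega

theorem IsAtomWord.isExpression {J I : Finset (Fin n)} {u : List ℕ} {T : List (Finset (Fin n))}
    (h : IsAtomWord J u (I :: T)) : IsExpression I J (I :: T) := by
  generalize hE : I :: T = E at h
  induction h generalizing I T with
  | nil =>
    obtain ⟨rfl, rfl⟩ := List.cons.inj hE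
    simp [IsExpression]
  | cons i u I' M K E h _ ih =>
    obtain ⟨rfl, rfl⟩ := List.cons.inj hE
    obtain ⟨s, t, h⟩ := isAtom_iff.1 h
    obtain ⟨-, h1, h2⟩ := ih rfl
    refine ⟨rfl, by rw [List.getLast?_cons_cons, List.getLast?_cons_cons, h1], ?_⟩
    rw [List.isChain_cons_cons, List.isChain_cons_cons]
    exact ⟨h.adjacent_left, h.adjacent_right, h2⟩

theorem IsAtomWord.isAtomicExpr {J : Finset (Fin n)} {u : List ℕ} {E : List (Finset (Fin n))}
    (h : IsAtomWord J u E) : IsAtomicExpr E := by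
  induction h with
  | nil => exact .nil _
  | cons i u I M K E h _ ih =>
    obtain ⟨s, t, h⟩ := isAtom_iff.1 h
    exact .cons _ _ _ _ _ h.isAtomic h.isReducedExpr ih

theorem IsAtomWord.isAtomicReducedExpr {J I : Finset (Fin n)} {u : List ℕ}
    {T : List (Finset (Fin n))} {x : Equiv.Perm (Fin (n + 1))}
    (h : IsAtomWord J u (I :: T)) (hu : RedWord u) (hx : Rep I J (wordPerm u) x) :
    IsAtomicReducedExpr I J (DoubleCoset.doubleCoset x (parabolic I) (parabolic J)) (I :: T) := by
  obtain ⟨y, hy, h1, -, h3⟩ := h.exists_rep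
  obtain rfl := hx.perm_eq hy
  exact ⟨⟨⟨_, rfl⟩, h.isExpression, h1 ▸ hx.isMaxElt, h3.2 hu⟩, h.isAtomicExpr⟩

theorem IsAtomicExpr.exists_word {J : Finset (Fin n)} {E : List (Finset (Fin n))}
    (h : IsAtomicExpr E) (hJ : E.getLast? = some J) : ∃ u, IsAtomWord J u E := by
  induction h with
  | nil I =>
    obtain rfl : I = J := by simpa using hJ
    exact ⟨[], .nil⟩
  | cons I M K E q hq hr _ ih =>
    obtain ⟨u, hu⟩ := ih (by rwa [List.getLast?_cons_cons, List.getLast?_cons_cons] at hJ)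
    obtain ⟨i, s, t, h⟩ := hq.exists_atomData hr
    exact ⟨i :: u, .cons i u I M K E h.isAtom hu⟩

theorem IsAtomicReducedExpr.exists_word {I J : Finset (Fin n)} {p : Set (Equiv.Perm (Fin (n + 1)))}
    {E : List (Finset (Fin n))} (h : IsAtomicReducedExpr I J p E) :
    ∃ u T x, E = I :: T ∧ IsAtomWord J u E ∧ RedWord u ∧ Rep I J (wordPerm u) x ∧
      p = DoubleCoset.doubleCoset x (parabolic I) (parabolic J) := by
  obtain ⟨⟨⟨w, rfl⟩, ⟨h1, h2, -⟩, h3, h4⟩, h5⟩ := h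
  obtain ⟨u, hu⟩ := h5.exists_word h2
  obtain ⟨T, rfl⟩ : ∃ T, E = I :: T := by
    cases E with
    | nil => simp at h1
    | cons A T => exact ⟨T, by simpa using h1⟩
  obtain ⟨x, hx, h6, -, h7⟩ := hu.exists_rep
  refine ⟨u, T, x, rfl, hu, h7.1 h4, hx, ?_⟩
  rw [← DoubleCoset.doubleCoset_eq_of_mem h3.1, h6]
  exact DoubleCoset.doubleCoset_eq_of_mem hx.isMaxElt.1

theorem IsAtomWord.append {K J : Finset (Fin n)} {u v : List ℕ} {X T : List (Finset (Fin n))}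
    (hX : IsAtomWord K u X) (hT : IsAtomWord J v (K :: T)) : IsAtomWord J (u ++ v) (X ++ T) := by
  induction hX with
  | nil => exact hT
  | cons i u I M L E h _ ih => exact .cons _ _ _ _ _ _ h ih

/-! ### Braids of atoms -/

/-- The two walks end at the same `I` because the braid relation equates their block permutations.
At each atom the cut not involved keeps its index, so on both sides the new cuts of `I` have indices
`i` and `i + 1`; this identifies `a` and `c` across the two walks. -/
theorem exists_braid_atoms {J : Finset (Fin n)} {i : ℕ} {d e : Fin n} (he : IsCut J i e)
    (hd : IsCut J (i + 1) d) :
    ∃ (I K L K' L' : Finset (Fin n)) (a b c f : Fin n),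
      AtomData i L (insert e J) J e b ∧ AtomData (i + 1) K (insert d L) L d c ∧
      AtomData i I (insert b K) K b a ∧
      AtomData (i + 1) L' (insert d J) J d f ∧ AtomData i K' (insert e L') L' e a ∧
      AtomData (i + 1) I (insert f K') K' f c := by
  have hne : ∀ {J : Finset (Fin n)} {r r' : Fin n}, IsCut J i r → IsCut J (i + 1) r' →
      r ≠ r' := by
    rintro J r _ h1 h2 rfl
    have := h1.2.symm.trans h2.2
    omega
  have hmem : ∀ {J : Finset (Fin n)} {r r' : Fin n} {j : ℕ}, IsCut J j r → r ≠ r' →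
      r ∉ insert r' J := by
    intro J r r' j h1 h2 h3
    exact (Finset.mem_insert.1 h3).elim h2 h1.1
  obtain ⟨b, h1⟩ := exists_atomData he
  have hd' := h1.isCut_of_notMem (hmem hd (hne he hd).symm) hd
  obtain ⟨c, h2⟩ := exists_atomData hd'
  have hb := h2.isCut_of_notMem (hmem h1.cut_left (hne h1.cut_left hd')) h1.cut_left
  obtain ⟨a, h3⟩ := exists_atomData hb
  have hc := h3.isCut_of_notMem (hmem h2.cut_left (hne hb h2.cut_left).symm) h2.cut_left
  obtain ⟨f, h4⟩ := exists_atomData hd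
  have he' := h4.isCut_of_notMem (hmem he (hne he hd)) he
  obtain ⟨a', h5⟩ := exists_atomData he'
  have hf := h5.isCut_of_notMem (hmem h4.cut_left (hne he' h4.cut_left).symm) h4.cut_left
  obtain ⟨c', h6⟩ := exists_atomData hf
  have ha' := h6.isCut_of_notMem (hmem h5.cut_left (hne h5.cut_left hf)) h5.cut_left
  have hI := (h3.rep.mul (h2.rep.mul h1.rep)).left_eq
    (swap_braid i ▸ h6.rep.mul (h5.rep.mul h4.rep))
  have ha := ha'.unique (hI ▸ h3.cut_left)
  have hc' := h6.cut_left.unique (hI ▸ hc)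
  rw [← hI] at h6
  subst ha hc'
  exact ⟨_, _, _, _, _, _, b, _, f, h1, h2, h3, h4, h5, h6⟩

theorem exists_comm_atoms {J : Finset (Fin n)} {i j : ℕ} {b d : Fin n}
    (hij : i + 1 < j ∨ j + 1 < i) (hb : IsCut J i b) (hd : IsCut J j d) :
    ∃ (I K K' : Finset (Fin n)) (a c : Fin n),
      AtomData j K (insert d J) J d c ∧ AtomData i I (insert b K) K b a ∧
      AtomData i K' (insert b J) J b a ∧ AtomData j I (insert d K') K' d c := by
  have hne : ∀ {J : Finset (Fin n)} {r r' : Fin n}, IsCut J i r → IsCut J j r' → r ≠ r' := by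
    rintro J r _ h1 h2 rfl
    have := h1.2.symm.trans h2.2
    omega
  have hmem : ∀ {J : Finset (Fin n)} {r r' : Fin n} {j : ℕ}, IsCut J j r → r ≠ r' →
      r ∉ insert r' J := by
    intro J r r' j h1 h2 h3
    exact (Finset.mem_insert.1 h3).elim h2 h1.1
  obtain ⟨c, h1⟩ := exists_atomData hd
  have hb' := h1.isCut_of_notMem (hmem hb (hne hb hd)) hb
  obtain ⟨a, h2⟩ := exists_atomData hb'
  have hc := h2.isCut_of_notMem (hmem h1.cut_left (hne hb' h1.cut_left).symm) h1.cut_left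
  obtain ⟨a', h3⟩ := exists_atomData hb
  have hd' := h3.isCut_of_notMem (hmem hd (hne hb hd).symm) hd
  obtain ⟨c', h4⟩ := exists_atomData hd'
  have ha' := h4.isCut_of_notMem (hmem h3.cut_left (hne h3.cut_left hd')) h3.cut_left
  have hI := (h2.rep.mul h1.rep).left_eq (swap_commute hij ▸ h4.rep.mul h3.rep)
  have ha := ha'.unique (hI ▸ h2.cut_left)
  have hc' := h4.cut_left.unique (hI ▸ hc)
  rw [← hI] at h4
  subst ha hc'
  exact ⟨_, _, _, _, _, h1, h2, h3, h4⟩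

/-! ### Braid moves on atomic expressions -/

theorem exists_atomWord_braid {J : Finset (Fin n)} {i : ℕ} (h1 : 1 ≤ i)
    (h2 : i + 1 ≤ Jᶜ.card) :
    ∃ (I : Finset (Fin n)) (X Y : List (Finset (Fin n))),
      IsAtomWord J [i, i + 1, i] (I :: X) ∧ IsAtomWord J [i + 1, i, i + 1] (I :: Y) := by
  obtain ⟨e, he⟩ := exists_isCut h1 (by omega : i ≤ Jᶜ.card)
  obtain ⟨d, hd⟩ := exists_isCut (by omega) h2
  obtain ⟨I, K, L, K', L', a, b, c, f, a1, a2, a3, a4, a5, a6⟩ := exists_braid_atoms he hd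
  exact ⟨I, _, _,
    .cons _ _ _ _ _ _ a3.isAtom (.cons _ _ _ _ _ _ a2.isAtom (.cons _ _ _ _ _ _ a1.isAtom .nil)),
    .cons _ _ _ _ _ _ a6.isAtom (.cons _ _ _ _ _ _ a5.isAtom (.cons _ _ _ _ _ _ a4.isAtom .nil))⟩

theorem exists_atomWord_comm {J : Finset (Fin n)} {i j : ℕ} (hij : i + 1 < j ∨ j + 1 < i)
    (hi : 1 ≤ i ∧ i ≤ Jᶜ.card) (hj : 1 ≤ j ∧ j ≤ Jᶜ.card) :
    ∃ (I : Finset (Fin n)) (X Y : List (Finset (Fin n))),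
      IsAtomWord J [i, j] (I :: X) ∧ IsAtomWord J [j, i] (I :: Y) := by
  obtain ⟨b, hb⟩ := exists_isCut hi.1 hi.2
  obtain ⟨d, hd⟩ := exists_isCut hj.1 hj.2
  obtain ⟨I, K, K', a, c, a1, a2, a3, a4⟩ := exists_comm_atoms hij hb hd
  exact ⟨I, _, _, .cons _ _ _ _ _ _ a2.isAtom (.cons _ _ _ _ _ _ a1.isAtom .nil),
    .cons _ _ _ _ _ _ a4.isAtom (.cons _ _ _ _ _ _ a3.isAtom .nil)⟩

theorem IsAtom.unique {i : ℕ} {I I' M M' K : Finset (Fin n)} (h : IsAtom i I M K)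
    (h' : IsAtom i I' M' K) : I = I' ∧ M = M' := by
  obtain ⟨s, t, h⟩ := isAtom_iff.1 h
  obtain ⟨s', t', h'⟩ := isAtom_iff.1 h'
  obtain rfl := h.cut.unique h'.cut
  exact ⟨h.rep.left_eq h'.rep, h.eq_insert.trans h'.eq_insert.symm⟩

theorem IsAtomWord.unique {J : Finset (Fin n)} {u : List ℕ} {E F : List (Finset (Fin n))}
    (h : IsAtomWord J u E) (h' : IsAtomWord J u F) : E = F := by
  induction h generalizing F with
  | nil => cases h'; rfl
  | cons i u I M K E h _ ih =>
    cases h' with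
    | cons _ _ I' M' K' E' h' hE' =>
      obtain ⟨rfl, rfl⟩ := List.cons.inj (ih hE')
      obtain ⟨rfl, rfl⟩ := h.unique h'
      rfl

theorem IsAtom.bounds {i : ℕ} {I M K : Finset (Fin n)} (h : IsAtom i I M K) :
    (1 ≤ i ∧ i ≤ Kᶜ.card) ∧ Iᶜ.card = Kᶜ.card := by
  obtain ⟨s, t, h⟩ := isAtom_iff.1 h
  exact ⟨h.cut.bounds, h.card_compl_eq⟩

/-- An atom preserves the number of cuts, so the bound on a letter where it occurs is also a bound
at the place `K` where the word is split. This is what makes the replacement of a subword possible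
over `K`. -/
theorem IsAtomWord.split {J : Finset (Fin n)} {u v : List ℕ} {E : List (Finset (Fin n))}
    (h : IsAtomWord J (u ++ v) E) :
    ∃ K X T, IsAtomWord K u X ∧ IsAtomWord J v (K :: T) ∧ E = X ++ T ∧
      ∀ i ∈ u, 1 ≤ i ∧ i ≤ Kᶜ.card := by
  have key : ∀ {u : List ℕ} {J K : Finset (Fin n)} {E : List (Finset (Fin n))},
      IsAtomWord J u (K :: E) → Kᶜ.card = Jᶜ.card := by
    intro u J K E h
    generalize hE : K :: E = F at h
    induction h generalizing K E with
    | nil => rw [(List.cons.inj hE).1]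
    | cons i u I M L E h _ ih =>
      rw [(List.cons.inj hE).1, h.bounds.2, ih rfl]
  induction u generalizing E with
  | nil =>
    cases E with
    | nil => cases h
    | cons K T => exact ⟨K, [K], T, .nil, h, rfl, by simp⟩
  | cons i u ih =>
    cases h with
    | cons _ _ I M L E h hE =>
      obtain ⟨K, X, T, h1, h2, h3, h4⟩ := ih hE
      cases X with
      | nil => cases h1
      | cons L' X =>
        obtain ⟨rfl, rfl⟩ := List.cons.inj h3
        refine ⟨K, I :: M :: L :: X, T, .cons _ _ _ _ _ _ h h1, h2, rfl, ?_⟩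
        intro j hj
        rcases List.mem_cons.1 hj with rfl | hj
        · rw [← key h1]
          exact h.bounds.1
        · exact h4 j hj

theorem IsAtomWord.bounds {J : Finset (Fin n)} {u : List ℕ} {E : List (Finset (Fin n))}
    (h : IsAtomWord J u E) : ∀ i ∈ u, 1 ≤ i ∧ i ≤ Jᶜ.card := by
  rw [← List.append_nil u] at h
  obtain ⟨K, X, T, -, h2, -, h4⟩ := h.split
  cases h2
  exact h4

theorem IsAtomWord.replace {J : Finset (Fin n)} {u u' v : List ℕ} {E : List (Finset (Fin n))}
    (h : IsAtomWord J (u ++ v) E)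
    (hu : ∀ K : Finset (Fin n), (∀ i ∈ u, 1 ≤ i ∧ i ≤ Kᶜ.card) →
      ∃ I X Y, IsAtomWord K u (I :: X) ∧ IsAtomWord K u' (I :: Y)) :
    ∃ K X Y T, IsAtomWord K u X ∧ IsAtomWord K u' Y ∧ IsAtomWord J (u' ++ v) (Y ++ T) ∧
      E = X ++ T ∧ (Y ++ T).head? = E.head? := by
  obtain ⟨K, X, T, h1, h2, rfl, h4⟩ := h.split
  obtain ⟨I, X', Y, h5, h6⟩ := hu K h4
  obtain rfl := h1.unique h5
  exact ⟨K, _, _, T, h5, h6, h6.append h2, rfl, rfl⟩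

/-- Both sides of a braid relation use the same letters, so if one can be realised over `K`, so can
the other, with the same left end. The rest of the expression is then unaffected. -/
theorem IsAtomWord.braidStep {J : Finset (Fin n)} {u v : List ℕ} {E : List (Finset (Fin n))}
    (h : IsAtomWord J u E) (hs : BraidStep u v) :
    ∃ F, IsAtomWord J v F ∧ F.head? = E.head? ∧
      (InContext AtomicBraid E F ∨ InContext AtomicBraid F E) := by
  induction hs generalizing E with
  | braid i u =>
    obtain ⟨K, X, Y, T, h1, h2, h3, rfl, h5⟩ := h.replace (u := [i, i + 1, i])
      (u' := [i + 1, i, i + 1]) fun K hK =>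
        exists_atomWord_braid (hK i (by simp)).1 (hK (i + 1) (by simp)).2
    exact ⟨_, h3, h5, Or.inl ⟨[], X, Y, T, .braid K i X Y h1 h2, rfl, rfl⟩⟩
  | braid' i u =>
    obtain ⟨K, X, Y, T, h1, h2, h3, rfl, h5⟩ := h.replace (u := [i + 1, i, i + 1])
      (u' := [i, i + 1, i]) fun K hK => by
        obtain ⟨I, X, Y, hX, hY⟩ :=
          exists_atomWord_braid (hK i (by simp)).1 (hK (i + 1) (by simp)).2
        exact ⟨I, Y, X, hY, hX⟩
    exact ⟨_, h3, h5, Or.inr ⟨[], Y, X, T, .braid K i Y X h2 h1, rfl, rfl⟩⟩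
  | comm i j hij u =>
    obtain ⟨K, X, Y, T, h1, h2, h3, rfl, h5⟩ := h.replace (u := [i, j])
      (u' := [j, i]) fun K hK => exists_atomWord_comm hij (hK i (by simp)) (hK j (by simp))
    exact ⟨_, h3, h5, Or.inl ⟨[], X, Y, T, .comm K i j hij X Y h1 h2, rfl, rfl⟩⟩
  | cons i _ ih =>
    have hcons : ∀ {I M : Finset (Fin n)} {E F : List (Finset (Fin n))},
        InContext AtomicBraid E F → InContext AtomicBraid (I :: M :: E) (I :: M :: F) := by
      rintro I M E F ⟨A, X, Y, B, h, rfl, rfl⟩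
      exact ⟨I :: M :: A, X, Y, B, h, rfl, rfl⟩
    cases h with
    | cons _ _ I M K E h hE =>
      obtain ⟨F, h1, h2, h3⟩ := ih hE
      cases F with
      | nil => cases h1
      | cons K' F =>
        obtain rfl : K' = K := by simpa using h2
        exact ⟨I :: M :: K' :: F, .cons _ _ _ _ _ _ h h1, rfl, h3.imp hcons hcons⟩

theorem atomicMoves_of_braidEquiv {I J : Finset (Fin n)} {u v : List ℕ} (h : BraidEquiv u v)
    {x : Equiv.Perm (Fin (n + 1))} (hu : RedWord u) (hx : Rep I J (wordPerm u) x)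
    {E F : List (Finset (Fin n))} (hE : IsAtomWord J u E) (hI : E.head? = some I)
    (hF : IsAtomWord J v F) :
    Relation.ReflTransGen
      (AtomicMove I J (DoubleCoset.doubleCoset x (parabolic I) (parabolic J))) E F := by
  induction h using Relation.ReflTransGen.head_induction_on generalizing E with
  | refl =>
    rw [hE.unique hF]
  | head hs _ ih =>
    obtain ⟨G, h1, h2, h3⟩ := hE.braidStep hs
    have hred := hs.redWord hu
    have hx' := hs.wordPerm_eq ▸ hx
    have aux : ∀ {w : List ℕ} {E : List (Finset (Fin n))}, IsAtomWord J w E → RedWord w →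
        Rep I J (wordPerm w) x → E.head? = some I → IsAtomicReducedExpr I J
          (DoubleCoset.doubleCoset x (parabolic I) (parabolic J)) E := by
      intro w E hE hw hx hI
      cases E with
      | nil => simp at hI
      | cons A T =>
        obtain rfl : A = I := by simpa using hI
        exact hE.isAtomicReducedExpr hw hx
    exact .head ⟨aux hE hu hx hI, aux h1 hred hx' (h2.trans hI), h3⟩ (ih hred hx' h1 (h2.trans hI))

/-! ### The coset determines the permutation of the block numbers. -/

theorem exists_blk_eq {J : Finset (Fin n)} {m : ℕ} (h1 : 1 ≤ m) (h2 : m ≤ Jᶜ.card + 1) :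
    ∃ p, blk J p = m := by
  rcases h2.eq_or_lt with rfl | h2
  · exact ⟨_, blk_last J⟩
  · obtain ⟨r, hr⟩ := exists_isCut h1 (Nat.lt_succ_iff.1 h2)
    exact ⟨_, hr.2⟩

theorem wordPerm_apply_of_notMem {u : List ℕ} {m : ℕ} (h : ∀ i ∈ u, m ≠ i ∧ m ≠ i + 1) :
    wordPerm u m = m := by
  induction u with
  | nil => rfl
  | cons i u ih =>
    simp only [List.mem_cons, forall_eq_or_imp] at h
    rw [wordPerm, Equiv.Perm.mul_apply, ih h.2, swap_apply_other h.1.1 h.1.2]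

theorem reflTransGen_atomicMove {I J : Finset (Fin n)} {p : Set (Equiv.Perm (Fin (n + 1)))}
    {E F : List (Finset (Fin n))} (hE : IsAtomicReducedExpr I J p E)
    (hF : IsAtomicReducedExpr I J p F) : Relation.ReflTransGen (AtomicMove I J p) E F := by
  obtain ⟨u, T, x, rfl, hE', hu, hx, rfl⟩ := hE.exists_word
  obtain ⟨v, T', y, rfl, hF', hv, hy, hp⟩ := hF.exists_word
  -- The unique maximal element of `p` is both `x w_J` and `y w_J`.
  have hxy : x = y := by
    have h1 := hy.isMaxElt
    rw [← hp] at h1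
    exact (mul_right_cancel (hx.eq_of_isMaxElt h1)).symm
  subst hxy
  have hw : wordPerm v = wordPerm u := by
    ext m
    -- Actual block numbers run from `1` to `Jᶜ.card + 1`, and there `x` determines the permutation.
    -- Letters of both words lie between `1` and `Jᶜ.card`, so all other numbers are fixed by both.
    by_cases hm : 1 ≤ m ∧ m ≤ Jᶜ.card + 1
    · obtain ⟨q, rfl⟩ := exists_blk_eq hm.1 hm.2
      rw [← hx.blk_eq, ← hy.blk_eq]
    · rw [wordPerm_apply_of_notMem fun i hi => ?_, wordPerm_apply_of_notMem fun i hi => ?_]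
      · have := hE'.bounds i hi
        omega
      · have := hF'.bounds i hi
        omega
  exact atomicMoves_of_braidEquiv (braidEquiv_of_wordPerm_eq hv hu hw) hu hx hE' rfl hF'

/-! ### Switchback relations -/

/-- Inside a block of `J` the factor `w_J` makes the product decreasing; across a cut `r ∈ Q` the
reversal by `π` does. Hence the product is decreasing on the blocks of `Q`. -/
theorem Rep.mul_longest_eq {I J Q : Finset (Fin n)} {π : Equiv.Perm ℕ}
    {x : Equiv.Perm (Fin (n + 1))} (h : Rep I J π x) (hx : x ∈ parabolic Q) (hJ : J ⊆ Q)
    (hQ : ∀ r ∈ Q, r ∉ J → π (blk J r.succ) < π (blk J r.castSucc)) :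
    x * longest J = longest Q := by
  refine eq_longest (blk_apply (mul_mem hx (parabolic_mono hJ (longest_mem J)))) fun r hr => ?_
  rw [Equiv.Perm.mul_apply, Equiv.Perm.mul_apply]
  by_cases hrJ : r ∈ J
  · refine h.inc.lt ?_ (longest_decOn J r hrJ)
    rw [blk_longest, blk_longest, blk_succ_of_mem hrJ]
  · refine lt_of_blk_lt (J := I) ?_
    rw [h.blk_eq, h.blk_eq, blk_longest, blk_longest]
    exact hQ r hr hrJ

/-- Conjugation by `w_Q` sends the two letters of `t` into blocks `π l` and `π (l + 1)` of `I`. If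
it gave `s`, these would be blocks `m` and `m + 1`. -/
theorem simple_ne_conj_longest {I J Q : Finset (Fin n)} {π : Equiv.Perm ℕ}
    {x : Equiv.Perm (Fin (n + 1))} (h : Rep I J π x) (hQ : x * longest J = longest Q)
    {s t : Fin n} {l m : ℕ} (hs : IsCut I m s) (ht : IsCut J l t)
    (hne : (π l ≠ m ∧ π l ≠ m + 1) ∨ (π (l + 1) ≠ m ∧ π (l + 1) ≠ m + 1)) :
    simple t ≠ longest Q * simple s * longest Q := by
  intro he
  have h1 : simple s = longest Q * simple t * (longest Q)⁻¹ := by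
    rw [he, longest_inv]
    simp only [mul_assoc, longest_mul_self, mul_one]
    rw [← mul_assoc, longest_mul_self, one_mul]
  have hb : ∀ p, blk I (longest Q p) = π (blk J p) := fun p => by
    rw [← hQ, Equiv.Perm.mul_apply, h.blk_eq, blk_longest]
  have h2 := hb t.castSucc
  have h3 := hb t.succ
  rw [ht.2] at h2
  rw [ht.succ] at h3
  rw [conj_simple] at h1
  rcases swap_eq_simple h1 with ⟨h4, h5⟩ | ⟨h4, h5⟩ <;>
    rw [h4] at h2 <;> rw [h5] at h3 <;> rw [hs.2] at * <;> rw [hs.succ] at * <;> omega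

/-- `x` already matches `K` with `L`, and `hne` forbids any match outside them, so enlarging to `I'`
and `J'` creates no new redundancy. -/
theorem Rep.redundancies {I' J' K L : Finset (Fin n)} {π : Equiv.Perm ℕ}
    {x : Equiv.Perm (Fin (n + 1))} (h : Rep K L π x) (hK : K ⊆ I') (hL : L ⊆ J')
    (hne : ∀ s ∈ I', s ∉ K → ∀ t ∈ J', t ∉ L → simple s ≠ x * simple t * x⁻¹) :
    leftRed I' J' x = K ∧ rightRed I' J' x = L := by
  classical
  have key : ∀ s ∈ I', ∀ t ∈ J', simple s = x * simple t * x⁻¹ → s ∈ K ∧ t ∈ L := by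
    intro s hs t ht he
    by_cases hsK : s ∈ K
    · obtain ⟨t', ht', h1⟩ := h.exists_conj' hsK
      have : t' = t := simple_injective (by rw [h1, he]; group)
      exact ⟨hsK, this ▸ ht'⟩
    · by_cases htL : t ∈ L
      · obtain ⟨s', hs', h1⟩ := h.exists_conj htL
        exact absurd (simple_injective (h1.trans he.symm) ▸ hs') hsK
      · exact absurd he (hne s hs hsK t ht htL)
  constructor
  · ext s
    simp only [leftRed, Finset.mem_filter]
    refine ⟨fun ⟨hs, t, ht, he⟩ => (key s hs t ht he).1, fun hs => ⟨hK hs, ?_⟩⟩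
    obtain ⟨t, ht, he⟩ := h.exists_conj' hs
    exact ⟨t, hL ht, by rw [he]; group⟩
  · ext t
    simp only [rightRed, Finset.mem_filter]
    refine ⟨fun ⟨ht, s, hs, he⟩ => (key s hs t ht (by rw [he]; group)).2, fun ht => ⟨hL ht, ?_⟩⟩
    obtain ⟨s, hs, he⟩ := h.exists_conj ht
    exact ⟨s, hK hs, by rw [he]; group⟩

/-- With `I` and `J` inside `Q`, the whole double coset of `w_Q` lies in `W_Q`, so `w_Q` is its
maximal element. -/
theorem isReducedExpr_of_exprProd_eq_longest {I J Q : Finset (Fin n)} (hI : I ⊆ Q) (hJ : J ⊆ Q)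
    {E : List (Finset (Fin n))} (hE : IsExpression I J E) (h1 : exprProd E = longest Q)
    (h2 : exprLength E = length (longest Q)) :
    IsReducedExpr I J (DoubleCoset.doubleCoset (longest Q) (parabolic I) (parabolic J)) E := by
  refine ⟨⟨_, rfl⟩, hE, ?_, by rw [h1, h2]⟩
  rw [h1]
  refine ⟨DoubleCoset.mem_doubleCoset_self _ _ _, fun y hy => ?_⟩
  obtain ⟨a, ha, b, hb, rfl⟩ := DoubleCoset.mem_doubleCoset.1 hy
  exact length_le_longest (mul_mem (mul_mem (parabolic_mono hI ha) (longest_mem Q))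
    (parabolic_mono hJ hb))

theorem isExpression_peak {Q : Finset (Fin n)} {s t : Fin n} (hs : s ∈ Q) (ht : t ∈ Q) :
    IsExpression (Q.erase s) (Q.erase t) [Q.erase s, Q, Q.erase t] := by
  refine ⟨rfl, rfl, ?_⟩
  simp only [List.isChain_cons_cons, List.isChain_singleton, and_true]
  exact ⟨Or.inl ⟨s, Finset.notMem_erase _ _, (Finset.insert_erase hs).symm⟩, Or.inr ⟨t, ht, rfl⟩⟩

theorem switchback_of_rep {Q K L : Finset (Fin n)} {s t : Fin n} {π : Equiv.Perm ℕ}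
    {x : Equiv.Perm (Fin (n + 1))} {A : List (Finset (Fin n))} (hs : s ∈ Q) (ht : t ∈ Q)
    (hst : simple t ≠ longest Q * simple s * longest Q) (hx : Rep K L π x)
    (hK : K ⊆ Q.erase s) (hL : L ⊆ Q.erase t)
    (hne : ∀ s' ∈ Q.erase s, s' ∉ K → ∀ t' ∈ Q.erase t, t' ∉ L →
      simple s' ≠ x * simple t' * x⁻¹)
    (hinc : IncOn (Q.erase t) x) (hinc' : IncOn (Q.erase s) x⁻¹)
    (hmem : longest Q ∈ DoubleCoset.doubleCoset x (parabolic (Q.erase s)) (parabolic (Q.erase t)))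
    (hA : IsAtomicReducedExpr K L (DoubleCoset.doubleCoset x (parabolic K) (parabolic L)) A)
    (hE : IsExpression (Q.erase s) (Q.erase t) ([Q.erase s] ++ A ++ [Q.erase t]))
    (h1 : exprProd ([Q.erase s] ++ A ++ [Q.erase t]) = longest Q)
    (h2 : exprLength ([Q.erase s] ++ A ++ [Q.erase t]) = length (longest Q)) :
    Switchback [Q.erase s, Q, Q.erase t] ([Q.erase s] ++ A ++ [Q.erase t]) := by
  obtain ⟨h3, h4⟩ := hx.redundancies hK hL hne
  refine ⟨Q, s, t, _, K, L, _, A, hs, ht, hst, rfl,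
    isReducedExpr_of_exprProd_eq_longest (Finset.erase_subset _ _) (Finset.erase_subset _ _)
      (isExpression_peak hs ht) ?_ ?_, ⟨⟨_, rfl⟩, ⟨_, rfl⟩, x, ?_, hx.isMinElt, h3.symm, h4.symm⟩,
    hA, rfl, isReducedExpr_of_exprProd_eq_longest (Finset.erase_subset _ _)
      (Finset.erase_subset _ _) hE h1 h2⟩
  · rw [exprProd_of_subset (Finset.erase_subset _ _), exprProd_of_superset (Finset.erase_subset _ _),
      exprProd, mul_assoc, longest_mul_self, mul_one]
  · rw [exprLength_of_subset (Finset.erase_subset _ _),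
      exprLength_of_superset (Finset.erase_subset _ _), exprLength]
    ring
  · rw [DoubleCoset.doubleCoset_eq_of_mem hmem]
    exact isMinElt_of_incOn hinc hinc'

theorem isAtomicReducedExpr_singleton (K : Finset (Fin n)) :
    IsAtomicReducedExpr K K (DoubleCoset.doubleCoset 1 (parabolic K) (parabolic K)) [K] :=
  IsAtomWord.nil.isAtomicReducedExpr (u := []) trivial (Rep.one K)

theorem AtomData.isAtomicReducedExpr {j : ℕ} {K M L : Finset (Fin n)} {s t : Fin n}
    (h : AtomData j K M L s t) :
    IsAtomicReducedExpr K L (DoubleCoset.doubleCoset (longest M * longest L) (parabolic K)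
      (parabolic L)) [K, M, L] := by
  refine (IsAtomWord.cons j [] _ _ _ _ h.isAtom .nil).isAtomicReducedExpr ?_ ?_
  · simp [RedWord, wordPerm]
  · simpa [wordPerm] using h.rep

theorem switchback_trivial {Q K : Finset (Fin n)} {s t : Fin n} (hs : s ∈ Q) (ht : t ∈ Q)
    (hst : simple t ≠ longest Q * simple s * longest Q) (hne : s ≠ t)
    (hsK : s ∉ K) (htK : t ∉ K) (h1 : Q.erase s = insert t K) (h2 : Q.erase t = insert s K)
    (h3 : exprProd [Q.erase s, K, Q.erase t] = longest Q)
    (h4 : exprLength [Q.erase s, K, Q.erase t] = length (longest Q)) :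
    Switchback [Q.erase s, Q, Q.erase t] [Q.erase s, K, Q.erase t] := by
  have hK : K ⊆ Q.erase s := h1 ▸ Finset.subset_insert _ _
  have hK' : K ⊆ Q.erase t := h2 ▸ Finset.subset_insert _ _
  refine switchback_of_rep (A := [K]) hs ht hst (Rep.one K) hK hK' ?_
    (fun _ _ => Fin.castSucc_lt_succ) (fun _ _ => Fin.castSucc_lt_succ) ?_
    (isAtomicReducedExpr_singleton K) ⟨rfl, rfl, ?_⟩ h3 h4
  · intro s' hs' hsK' t' ht' htK' he
    rw [h1, Finset.mem_insert] at hs'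
    rw [h2, Finset.mem_insert] at ht'
    rw [hs'.resolve_right hsK', ht'.resolve_right htK', inv_one, one_mul, mul_one] at he
    exact hne (simple_injective he).symm
  · rw [← h3, exprProd_of_superset hK, exprProd_of_subset hK', exprProd]
    exact DoubleCoset.mem_doubleCoset.2 ⟨_, mul_mem (longest_mem _)
      (parabolic_mono hK (longest_mem _)), _, longest_mem _, by group⟩
  · simp only [List.cons_append, List.nil_append, List.isChain_cons_cons, List.isChain_singleton,
      and_true]
    exact ⟨Or.inr ⟨t, h1 ▸ Finset.mem_insert_self _ _, by rw [h1, Finset.erase_insert htK]⟩,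
      Or.inl ⟨s, hsK, h2⟩⟩

theorem Rep.incOn_insert {K L : Finset (Fin n)} {π : Equiv.Perm ℕ}
    {x : Equiv.Perm (Fin (n + 1))} (h : Rep K L π x) {b : Fin n} {m : ℕ} (hb : IsCut L m b)
    (hm : π m < π (m + 1)) : IncOn (insert b L) x := by
  intro r hr
  rcases Finset.mem_insert.1 hr with rfl | hr
  · exact lt_of_blk_lt (J := K) (by rwa [h.blk_eq, h.blk_eq, hb.2, hb.succ])
  · exact h.inc r hr

/-- The atom swaps blocks `j` and `j + 1`, where `j` is adjacent to `m`. Of blocks `m` and `m + 1`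
exactly one moves, and their order survives. The order makes the atom's representative minimal also
after `b` is added on both sides; the move prevents it from conjugating `b` to `b`, so the
redundancies remain `K` and `L`. -/
theorem switchback_atom {Q K M L : Finset (Fin n)} {s t b s' t' : Fin n} {j m : ℕ}
    (hs : s ∈ Q) (ht : t ∈ Q) (hst : simple t ≠ longest Q * simple s * longest Q)
    (hA : AtomData j K M L s' t') (hK : IsCut K m b) (hL : IsCut L m b) (hm : j = m + 1 ∨ m = j + 1)
    (h1 : Q.erase s = insert b K) (h2 : Q.erase t = insert b L)
    (h3 : exprProd [Q.erase s, K, M, L, Q.erase t] = longest Q)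
    (h4 : exprLength [Q.erase s, K, M, L, Q.erase t] = length (longest Q)) :
    Switchback [Q.erase s, Q, Q.erase t] [Q.erase s, K, M, L, Q.erase t] := by
  have hKs : K ⊆ Q.erase s := h1 ▸ Finset.subset_insert _ _
  have hLt : L ⊆ Q.erase t := h2 ▸ Finset.subset_insert _ _
  have hπ : Equiv.swap j (j + 1) m < Equiv.swap j (j + 1) (m + 1) ∧
      ¬ (Equiv.swap j (j + 1) m = m ∧ Equiv.swap j (j + 1) (m + 1) = m + 1) := by
    rw [Equiv.swap_apply_def, Equiv.swap_apply_def]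
    split_ifs <;> omega
  refine switchback_of_rep (A := [K, M, L]) hs ht hst hA.rep hKs hLt ?_ ?_ ?_ ?_
    hA.isAtomicReducedExpr ⟨rfl, rfl, ?_⟩ h3 h4
  · intro r hr hrK r' hr' hrL' he
    rw [h1, Finset.mem_insert] at hr
    rw [h2, Finset.mem_insert] at hr'
    obtain rfl := hr.resolve_right hrK
    obtain rfl := hr'.resolve_right hrL'
    rw [conj_simple] at he
    have h5 := hA.rep.blk_eq r'.castSucc
    have h6 := hA.rep.blk_eq r'.succ
    rw [hL.2] at h5
    rw [hL.succ] at h6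
    rcases swap_eq_simple he with ⟨h7, h8⟩ | ⟨h7, h8⟩
    · rw [h7, hK.2] at h5
      rw [h8, hK.succ] at h6
      exact hπ.2 ⟨h5.symm, h6.symm⟩
    · rw [h7, hK.succ] at h5
      rw [h8, hK.2] at h6
      omega
  · rw [h2]
    exact hA.rep.incOn_insert hL hπ.1
  · rw [h1]
    exact hA.rep.inv.incOn_insert hK (by rw [Equiv.swap_inv]; exact hπ.1)
  · rw [← h3, exprProd_of_superset hKs, hA.exprProd_eq, exprProd_of_subset hLt, exprProd]
    exact DoubleCoset.mem_doubleCoset.2 ⟨_, mul_mem (longest_mem _)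
      (parabolic_mono hKs (longest_mem _)), _, longest_mem _, by group⟩
  · simp only [List.cons_append, List.nil_append, List.isChain_cons_cons, List.isChain_singleton,
      and_true]
    exact ⟨Or.inr ⟨b, h1 ▸ Finset.mem_insert_self _ _, by rw [h1, Finset.erase_insert hK.1]⟩,
      hA.adjacent_left, hA.adjacent_right, Or.inl ⟨b, hL.1, h2⟩⟩

/-- Ascending steps contribute nothing and the descent from `Q` telescopes, so the product is `w_Q`
and the length sum is `ℓ(Q)`, whatever the order of the steps. -/
theorem isReducedExpr_mountain {I M Q N J : Finset (Fin n)} {p : Set (Equiv.Perm (Fin (n + 1)))}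
    {a c d e : Fin n} (hp : IsCoset I J p) (hmax : IsMaxElt p (longest Q))
    (ha : a ∉ I) (hM : M = insert a I) (hc : c ∉ M) (hQ : Q = insert c M)
    (hd : d ∉ N) (hQ' : Q = insert d N) (he : e ∉ J) (hN : N = insert e J) :
    walk I [Step.add a, Step.add c, Step.sub d, Step.sub e] = [I, M, Q, N, J] ∧
      IsReducedExpr I J p [I, M, Q, N, J] := by
  have hIM : I ⊆ M := hM ▸ Finset.subset_insert _ _
  have hMQ : M ⊆ Q := hQ ▸ Finset.subset_insert _ _
  have hNQ : N ⊆ Q := hQ' ▸ Finset.subset_insert _ _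
  have hJN : J ⊆ N := hN ▸ Finset.subset_insert _ _
  have h1 : exprProd [I, M, Q, N, J] = longest Q := by
    rw [exprProd_of_subset hIM, exprProd_of_subset hMQ, exprProd_of_superset hNQ,
      exprProd_of_superset hJN, exprProd]
    simp only [mul_assoc, longest_mul_self, mul_one]
  have hN' : Q.erase d = N := by rw [hQ', Finset.erase_insert hd]
  have hJ' : N.erase e = J := by rw [hN, Finset.erase_insert he]
  refine ⟨by simp only [walk, ← hM, ← hQ, hN', hJ'], hp, ⟨rfl, rfl, ?_⟩, by rwa [h1], ?_⟩
  · simp only [List.isChain_cons_cons, List.isChain_singleton, and_true]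
    exact ⟨Or.inl ⟨a, ha, hM⟩, Or.inl ⟨c, hc, hQ⟩,
      Or.inr ⟨d, hQ' ▸ Finset.mem_insert_self _ _, hN'.symm⟩,
      Or.inr ⟨e, hN ▸ Finset.mem_insert_self _ _, hJ'.symm⟩⟩
  · rw [h1, exprLength_of_subset hIM, exprLength_of_subset hMQ, exprLength_of_superset hNQ,
      exprLength_of_superset hJN, exprLength]
    ring

/-! ### The atomic braid relations as double coset braid relations -/

open Step in
theorem mountain_moves {I J M M' N N' Q : Finset (Fin n)} {p : Set (Equiv.Perm (Fin (n + 1)))}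
    {a c d e : Fin n} (hp : IsCoset I J p) (hmax : IsMaxElt p (longest Q))
    (ha : a ∉ I) (hc : c ∉ I) (hac : a ≠ c) (hd : d ∉ J) (he : e ∉ J) (hde : d ≠ e)
    (hM : M = insert a I) (hM' : M' = insert c I) (hN : N = insert e J) (hN' : N' = insert d J)
    (hQ : Q = insert c M) (hQ' : Q = insert d N) :
    (walk I [add a, add c, sub d, sub e] = [I, M, Q, N, J] ∧
      walk I [add c, add a, sub e, sub d] = [I, M', Q, N', J]) ∧
    IsReducedExpr I J p (walk I [add a, add c, sub d, sub e]) ∧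
    IsReducedExpr I J p (walk I [add c, add a, sub d, sub e]) ∧
    IsReducedExpr I J p (walk I [add c, add a, sub e, sub d]) ∧
    InContext UpUp (walk I [add a, add c, sub d, sub e]) (walk I [add c, add a, sub d, sub e]) ∧
    InContext DownDown (walk I [add c, add a, sub d, sub e])
      (walk I [add c, add a, sub e, sub d]) := by
  have hcM : c ∉ M := by simp [hM, hc, hac.symm]
  have haM' : a ∉ M' := by simp [hM', ha, hac]
  have hdN : d ∉ N := by simp [hN, hd, hde]
  have heN' : e ∉ N' := by simp [hN', he, hde.symm]
  have hQM : Q = insert a M' := by rw [hQ, hM, hM', Finset.insert_comm]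
  have hQN : Q = insert e N' := by rw [hQ', hN, hN', Finset.insert_comm]
  obtain ⟨w1, r1⟩ := isReducedExpr_mountain hp hmax ha hM hcM hQ hdN hQ' he hN
  obtain ⟨w2, r2⟩ := isReducedExpr_mountain hp hmax hc hM' haM' hQM hdN hQ' he hN
  obtain ⟨w3, r3⟩ := isReducedExpr_mountain hp hmax hc hM' haM' hQM heN' hQN hd hN'
  have hdQ : d ∈ Q := hQ' ▸ Finset.mem_insert_self _ _
  have heQ : e ∈ Q := hQN ▸ Finset.mem_insert_self _ _
  rw [w1, w2, w3]
  refine ⟨⟨rfl, rfl⟩, r1, r2, r3,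
    ⟨[], [I, M, Q], [I, M', Q], [N, J], ⟨I, a, c, ha, hc, hac, ?_, ?_⟩, rfl, rfl⟩,
    ⟨[I, M'], [Q, N, J], [Q, N', J], [], ⟨Q, d, e, hdQ, heQ, hde, ?_, ?_⟩, rfl, rfl⟩⟩
  · simp only [walk, ← hM, ← hQ]
  · simp only [walk, ← hM', ← hQM]
  · simp only [walk]
    rw [hQ', Finset.erase_insert hdN, hN, Finset.erase_insert he]
  · simp only [walk]
    rw [hQN, Finset.erase_insert heN', hN', Finset.erase_insert hd]

/-- An initial ascent and a final descent affect neither the product nor the length sum. Reducedness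
of a composite of three atoms therefore passes to the inner part needed by the switchback. -/
theorem expr_trim_atom {j : ℕ} {I J M N K P L : Finset (Fin n)} {s t : Fin n}
    (h : AtomData j K P L s t) (hI : I ⊆ M) (hK : K ⊆ M) (hL : L ⊆ N) (hJ : J ⊆ N) :
    exprProd [I, M, K, P, L, N, J] = exprProd [M, K, P, L, N] ∧
      exprLength [I, M, K, P, L, N, J] = exprLength [M, K, P, L, N] := by
  constructor
  · rw [exprProd_of_subset hI, exprProd_of_superset hK, exprProd_of_superset hK, h.exprProd_eq,
      h.exprProd_eq, exprProd_of_subset hL, exprProd_of_subset hL, exprProd_of_superset hJ,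
      exprProd, exprProd]
    simp only [mul_assoc, longest_mul_self, mul_one]
  · rw [exprLength_of_subset hI, exprLength_of_superset hK, exprLength_of_superset hK,
      h.exprLength_eq, h.exprLength_eq, exprLength_of_subset hL, exprLength_of_subset hL,
      exprLength_of_superset hJ, exprLength, exprLength]
    ring

theorem expr_trim {I J M N K : Finset (Fin n)} (hI : I ⊆ M) (hK : K ⊆ M) (hL : K ⊆ N)
    (hJ : J ⊆ N) :
    exprProd [I, M, K, N, J] = exprProd [M, K, N] ∧
      exprLength [I, M, K, N, J] = exprLength [M, K, N] := by
  constructor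
  · rw [exprProd_of_subset hI, exprProd_of_superset hK, exprProd_of_superset hK,
      exprProd_of_subset hL, exprProd_of_subset hL, exprProd_of_superset hJ, exprProd, exprProd]
    simp only [mul_assoc, longest_mul_self, mul_one]
  · rw [exprLength_of_subset hI, exprLength_of_superset hK, exprLength_of_superset hK,
      exprLength_of_subset hL, exprLength_of_subset hL, exprLength_of_superset hJ, exprLength,
      exprLength]
    ring

theorem IsCut.ne {J : Finset (Fin n)} {i j : ℕ} {r r' : Fin n} (h : IsCut J i r)
    (h' : IsCut J j r') (hij : i ≠ j) : r ≠ r' := by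
  rintro rfl
  exact hij (h.2.symm.trans h'.2)

theorem AtomData.mem_parabolic {i : ℕ} {I M K Q : Finset (Fin n)} {s t : Fin n}
    (h : AtomData i I M K s t) (hM : M ⊆ Q) : longest M * longest K ∈ parabolic Q :=
  mul_mem (parabolic_mono hM (longest_mem _))
    (parabolic_mono (h.right_subset.trans hM) (longest_mem _))

theorem inContext_switchback {I J P N Q : Finset (Fin n)} {Y : List (Finset (Fin n))} {s t : Fin n}
    (hs : Q.erase s = P) (ht : Q.erase t = N)
    (h : Switchback [Q.erase s, Q, Q.erase t] (Q.erase s :: Y)) :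
    InContext Switchback [I, P, Q, N, J] (I :: P :: (Y ++ [J])) :=
  ⟨[I], _, _, [J], h, by rw [hs, ht]; rfl, by rw [hs]; rfl⟩

theorem redWord_braid (i : ℕ) : RedWord [i, i + 1, i] := by
  simp only [RedWord, wordPerm_cons_inv, swap_apply_lower, swap_apply_upper,
    swap_apply_other (show i ≠ i + 1 by omega) (show i ≠ i + 1 + 1 by omega),
    swap_apply_other (show i + 1 + 1 ≠ i by omega) (show i + 1 + 1 ≠ i + 1 by omega)]
  simp [wordPerm]

theorem redWord_comm {i j : ℕ} (h : i + 1 < j ∨ j + 1 < i) : RedWord [i, j] := by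
  simp only [RedWord, wordPerm_cons_inv,
    swap_apply_other (show i ≠ j by omega) (show i ≠ j + 1 by omega),
    swap_apply_other (show i + 1 ≠ j by omega) (show i + 1 ≠ j + 1 by omega)]
  simp [wordPerm]

open Step in
theorem atomic_braid_eq_coset_braid (J : Finset (Fin n)) (i : ℕ) (hi : 1 ≤ i)
    (hi' : i + 1 ≤ Jᶜ.card) :
    ∃ (I : Finset (Fin n)) (p : Set (Equiv.Perm (Fin (n + 1)))) (a b c d e f : Fin n),
      IsCore I J p ∧
      IsAtomWord J [i, i + 1, i] (walk I [add a, sub b, add c, sub d, add b, sub e]) ∧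
      IsAtomWord J [i + 1, i, i + 1] (walk I [add c, sub f, add a, sub e, add f, sub d]) ∧
      IsAtomicReducedExpr I J p (walk I [add a, sub b, add c, sub d, add b, sub e]) ∧
      IsReducedExpr I J p (walk I [add a, add c, sub d, sub e]) ∧
      IsReducedExpr I J p (walk I [add c, add a, sub d, sub e]) ∧
      IsReducedExpr I J p (walk I [add c, add a, sub e, sub d]) ∧
      IsAtomicReducedExpr I J p (walk I [add c, sub f, add a, sub e, add f, sub d]) ∧
      InContext Switchback (walk I [add a, add c, sub d, sub e])
        (walk I [add a, sub b, add c, sub d, add b, sub e]) ∧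
      InContext UpUp (walk I [add a, add c, sub d, sub e])
        (walk I [add c, add a, sub d, sub e]) ∧
      InContext DownDown (walk I [add c, add a, sub d, sub e])
        (walk I [add c, add a, sub e, sub d]) ∧
      InContext Switchback (walk I [add c, add a, sub e, sub d])
        (walk I [add c, sub f, add a, sub e, add f, sub d]) := by
  obtain ⟨e, he⟩ := exists_isCut hi (by omega : i ≤ Jᶜ.card)
  obtain ⟨d, hd⟩ := exists_isCut (by omega) hi'
  obtain ⟨I, K, L, K', L', a, b, c, f, a1, a2, a3, a4, a5, a6⟩ := exists_braid_atoms he hd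
  have hde : d ≠ e := hd.ne he (by omega)
  have hac : a ≠ c := a3.cut_left.ne a6.cut_left (by omega)
  have hcb : c ∉ insert b K := by
    simp [a2.notMem_left, a2.cut_left.ne a3.cut (show i + 1 ≠ i by omega)]
  have haf : a ∉ insert f K' := by
    simp [a5.notMem_left, a5.cut_left.ne a6.cut (show i ≠ i + 1 by omega)]
  have hdJ : d ∉ insert e J := by simp [hd.1, hde]
  have heJ : e ∉ insert d J := by simp [he.1, hde.symm]
  set Q := insert d (insert e J) with hQ
  -- Since `L + b = J + e`, and similarly along both walks, every intermediate set lies in the same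
  -- `Q`, which is also `I` with `a` and `c` added.
  have hQ2 : Q = insert b (insert d L) := by rw [Finset.insert_comm, a1.insert_left]
  have hQ3 : Q = insert c (insert b K) := by rw [Finset.insert_comm, a2.insert_left, hQ2]
  have hQ4 : Q = insert e (insert d J) := by rw [Finset.insert_comm]
  have hQ5 : Q = insert f (insert e L') := by rw [Finset.insert_comm, a4.insert_left, hQ4]
  have hQ6 : Q = insert a (insert f K') := by rw [Finset.insert_comm, a5.insert_left, hQ5]
  have e1 : Q.erase c = insert b K := by rw [hQ3, Finset.erase_insert hcb]
  have e2 : Q.erase d = insert e J := by rw [hQ, Finset.erase_insert hdJ]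
  have e3 : Q.erase a = insert f K' := by rw [hQ6, Finset.erase_insert haf]
  have e4 : Q.erase e = insert d J := by rw [hQ4, Finset.erase_insert heJ]
  have hE : IsAtomWord J [i, i + 1, i] [I, insert b K, K, insert d L, L, insert e J, J] :=
    .cons _ _ _ _ _ _ a3.isAtom (.cons _ _ _ _ _ _ a2.isAtom (.cons _ _ _ _ _ _ a1.isAtom .nil))
  have hF : IsAtomWord J [i + 1, i, i + 1] [I, insert f K', K', insert e L', L', insert d J, J] :=
    .cons _ _ _ _ _ _ a6.isAtom (.cons _ _ _ _ _ _ a5.isAtom (.cons _ _ _ _ _ _ a4.isAtom .nil))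
  have hx := a3.rep.mul (a2.rep.mul a1.rep)
  have hxm := mul_mem (a3.mem_parabolic (Q := Q) (hQ3 ▸ Finset.subset_insert _ _))
    (mul_mem (a2.mem_parabolic (Q := Q) (hQ2 ▸ Finset.subset_insert _ _))
      (a1.mem_parabolic (Q := Q) (Finset.subset_insert d _)))
  set x := longest (insert b K) * longest K * (longest (insert d L) * longest L *
    (longest (insert e J) * longest J))
  set π := Equiv.swap i (i + 1) * (Equiv.swap (i + 1) (i + 1 + 1) * Equiv.swap i (i + 1)) with hπ
  have hπE : wordPerm [i, i + 1, i] = π := by simp [wordPerm, hπ]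
  have hπF : wordPerm [i + 1, i, i + 1] = π := hπE ▸ (BraidStep.braid i []).wordPerm_eq.symm
  have hπ1 : π i = i + 1 + 1 := by
    simp only [hπ, Equiv.Perm.mul_apply, Equiv.swap_apply_def]
    split_ifs <;> omega
  have hπ2 : π (i + 1) = i + 1 := by
    simp only [hπ, Equiv.Perm.mul_apply, Equiv.swap_apply_def]
    split_ifs <;> omega
  have hπ3 : π (i + 1 + 1) = i := by
    simp only [hπ, Equiv.Perm.mul_apply, Equiv.swap_apply_def]
    split_ifs <;> omega
  -- The permutation sends `i, i + 1, i + 2` to `i + 2, i + 1, i`, so it reverses the blocks at both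
  -- cuts `e` and `d` of `J` that `Q` removes.
  have hmaxQ : x * longest J = longest Q := by
    refine hx.mul_longest_eq hxm ((Finset.subset_insert _ _).trans (Finset.subset_insert _ _))
      fun r hr hrJ => ?_
    rw [hQ, Finset.mem_insert, Finset.mem_insert] at hr
    rcases hr with rfl | rfl | hr
    · rw [hd.succ, hd.2, hπ2, hπ3]
      omega
    · rw [he.succ, he.2, hπ1, hπ2]
      omega
    · exact absurd hr hrJ
  have hEr := hE.isAtomicReducedExpr (redWord_braid i) (hπE ▸ hx)
  have hFr := hF.isAtomicReducedExpr ((BraidStep.braid i []).redWord (redWord_braid i)) (hπF ▸ hx)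
  have hEp := (hx.eq_of_isMaxElt hEr.1.2.2.1).trans hmaxQ
  have hFp := (hx.eq_of_isMaxElt hFr.1.2.2.1).trans hmaxQ
  have hEl := hEr.1.2.2.2
  have hFl := hFr.1.2.2.2
  rw [hEp] at hEl
  rw [hFp] at hFl
  obtain ⟨t1, t2⟩ := expr_trim_atom a2 a3.left_subset a3.right_subset
    (a1.left_subset) a1.right_subset
  obtain ⟨t3, t4⟩ := expr_trim_atom a5 a6.left_subset a6.right_subset
    (a4.left_subset) a4.right_subset
  obtain ⟨⟨w1, w2⟩, r1, r2, r3, m1, m2⟩ := mountain_moves (p := DoubleCoset.doubleCoset x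
    (parabolic I) (parabolic J)) ⟨_, rfl⟩ (hmaxQ ▸ hx.isMaxElt) a3.notMem_left a6.notMem_left hac
    hd.1 he.1 hde a3.insert_left.symm a6.insert_left.symm rfl rfl hQ3 hQ
  have wE : walk I [add a, sub b, add c, sub d, add b, sub e] =
      [I, insert b K, K, insert d L, L, insert e J, J] := by
    rw [a3.walk_eq, a2.walk_eq, a1.walk_eq, walk]
  have wF : walk I [add c, sub f, add a, sub e, add f, sub d] =
      [I, insert f K', K', insert e L', L', insert d J, J] := by
    rw [a6.walk_eq, a5.walk_eq, a4.walk_eq, walk]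
  -- The core of this switchback is the middle atom `a_{i+1}`; the cut `b`, of index `i`, is carried
  -- through it. The condition on `c` and `d` holds because `π` sends block `i + 2` to `i`, which is
  -- not next to the cut `c` of index `i + 1`.
  have s1 := switchback_atom (Q := Q) (s := c) (t := d) (hQ3 ▸ Finset.mem_insert_self _ _)
    (Finset.mem_insert_self _ _)
    (simple_ne_conj_longest hx hmaxQ a6.cut_left hd (by rw [hπ3]; omega)) a2 a3.cut a1.cut_left
    (Or.inl rfl) e1 (e2.trans a1.insert_left.symm) (by rw [e1, e2, ← t1, hEp])
    (by rw [e1, e2, ← t2, hEl])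
  -- The mirror case: the core is the middle atom `a_i`, the cut `f` has index `i + 1`, and block
  -- `i` goes to `i + 2`, away from the cut `a` of index `i`.
  have s2 := switchback_atom (Q := Q) (s := a) (t := e) (hQ6 ▸ Finset.mem_insert_self _ _)
    (hQ4 ▸ Finset.mem_insert_self _ _)
    (simple_ne_conj_longest hx hmaxQ a3.cut_left he (by rw [hπ1]; omega)) a5 a6.cut a4.cut_left
    (Or.inr rfl) e3 (e4.trans a4.insert_left.symm) (by rw [e3, e4, ← t3, hFp])
    (by rw [e3, e4, ← t4, hFl])
  refine ⟨I, _, a, b, c, d, e, f, hx.isCore, wE ▸ hE, wF ▸ hF, wE ▸ hEr, r1, r2, r3, wF ▸ hFr,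
    ?_, m1, m2, ?_⟩
  · rw [w1, wE]
    have := inContext_switchback (I := I) (J := J) e1 e2 s1
    rwa [e2] at this
  · rw [w2, wF]
    have := inContext_switchback (I := I) (J := J) e3 e4 s2
    rw [e4] at this
    rwa [← a6.insert_left] at this ⊢

open Step in
theorem atomic_comm_eq_coset_braid (J : Finset (Fin n)) (i j : ℕ) (hi : 1 ≤ i)
    (hi' : i ≤ Jᶜ.card) (hj : 1 ≤ j) (hj' : j ≤ Jᶜ.card) (hij : i + 1 < j ∨ j + 1 < i) :
    ∃ (I : Finset (Fin n)) (p : Set (Equiv.Perm (Fin (n + 1)))) (a b c d : Fin n),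
      IsCore I J p ∧
      IsAtomWord J [i, j] (walk I [add a, sub b, add c, sub d]) ∧
      IsAtomWord J [j, i] (walk I [add c, sub d, add a, sub b]) ∧
      IsAtomicReducedExpr I J p (walk I [add a, sub b, add c, sub d]) ∧
      IsReducedExpr I J p (walk I [add a, add c, sub b, sub d]) ∧
      IsReducedExpr I J p (walk I [add c, add a, sub b, sub d]) ∧
      IsReducedExpr I J p (walk I [add c, add a, sub d, sub b]) ∧
      IsAtomicReducedExpr I J p (walk I [add c, sub d, add a, sub b]) ∧
      InContext Switchback (walk I [add a, add c, sub b, sub d])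
        (walk I [add a, sub b, add c, sub d]) ∧
      InContext UpUp (walk I [add a, add c, sub b, sub d])
        (walk I [add c, add a, sub b, sub d]) ∧
      InContext DownDown (walk I [add c, add a, sub b, sub d])
        (walk I [add c, add a, sub d, sub b]) ∧
      InContext Switchback (walk I [add c, add a, sub d, sub b])
        (walk I [add c, sub d, add a, sub b]) := by
  obtain ⟨b, hb⟩ := exists_isCut hi hi'
  obtain ⟨d, hd⟩ := exists_isCut hj hj'
  obtain ⟨I, K, K', a, c, a1, a2, a3, a4⟩ := exists_comm_atoms hij hb hd
  have hbd : b ≠ d := hb.ne hd (by omega)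
  have hac : a ≠ c := a2.cut_left.ne a4.cut_left (by omega)
  have hcb : c ≠ b := a1.cut_left.ne a2.cut (by omega)
  have had : a ≠ d := a3.cut_left.ne a4.cut (by omega)
  have hcK : c ∉ insert b K := by simp [a1.notMem_left, hcb]
  have haK : a ∉ insert d K' := by simp [a3.notMem_left, had]
  have hbJ : b ∉ insert d J := by simp [hb.1, hbd]
  have hdJ : d ∉ insert b J := by simp [hd.1, hbd.symm]
  set Q := insert b (insert d J) with hQ
  have hQ2 : Q = insert c (insert b K) := by rw [Finset.insert_comm, a1.insert_left]
  have hQ3 : Q = insert d (insert b J) := by rw [Finset.insert_comm]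
  have hQ4 : Q = insert a (insert d K') := by rw [Finset.insert_comm, a3.insert_left, hQ3]
  have e1 : Q.erase c = insert b K := by rw [hQ2, Finset.erase_insert hcK]
  have e2 : Q.erase b = insert d J := by rw [hQ, Finset.erase_insert hbJ]
  have e3 : Q.erase a = insert d K' := by rw [hQ4, Finset.erase_insert haK]
  have e4 : Q.erase d = insert b J := by rw [hQ3, Finset.erase_insert hdJ]
  have hE : IsAtomWord J [i, j] [I, insert b K, K, insert d J, J] :=
    .cons _ _ _ _ _ _ a2.isAtom (.cons _ _ _ _ _ _ a1.isAtom .nil)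
  have hF : IsAtomWord J [j, i] [I, insert d K', K', insert b J, J] :=
    .cons _ _ _ _ _ _ a4.isAtom (.cons _ _ _ _ _ _ a3.isAtom .nil)
  have hx := a2.rep.mul a1.rep
  have hxm := mul_mem (a2.mem_parabolic (Q := Q) (hQ2 ▸ Finset.subset_insert _ _))
    (a1.mem_parabolic (Q := Q) (Finset.subset_insert b _))
  set x := longest (insert b K) * longest K * (longest (insert d J) * longest J)
  set π := Equiv.swap i (i + 1) * Equiv.swap j (j + 1) with hπ
  have hπE : wordPerm [i, j] = π := by simp [wordPerm, hπ]
  have hπF : wordPerm [j, i] = π := hπE ▸ (BraidStep.comm i j hij []).wordPerm_eq.symm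
  have hπ1 : π i = i + 1 := by
    simp only [hπ, Equiv.Perm.mul_apply, Equiv.swap_apply_def]
    split_ifs <;> omega
  have hπ2 : π (i + 1) = i := by
    simp only [hπ, Equiv.Perm.mul_apply, Equiv.swap_apply_def]
    split_ifs <;> omega
  have hπ3 : π j = j + 1 := by
    simp only [hπ, Equiv.Perm.mul_apply, Equiv.swap_apply_def]
    split_ifs <;> omega
  have hπ4 : π (j + 1) = j := by
    simp only [hπ, Equiv.Perm.mul_apply, Equiv.swap_apply_def]
    split_ifs <;> omega
  have hmaxQ : x * longest J = longest Q := by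
    refine hx.mul_longest_eq hxm ((Finset.subset_insert _ _).trans (Finset.subset_insert _ _))
      fun r hr hrJ => ?_
    rw [hQ, Finset.mem_insert, Finset.mem_insert] at hr
    rcases hr with rfl | rfl | hr
    · rw [hb.succ, hb.2, hπ1, hπ2]
      omega
    · rw [hd.succ, hd.2, hπ3, hπ4]
      omega
    · exact absurd hr hrJ
  have hEr := hE.isAtomicReducedExpr (redWord_comm hij) (hπE ▸ hx)
  have hFr := hF.isAtomicReducedExpr (redWord_comm hij.symm) (hπF ▸ hx)
  have hEp := (hx.eq_of_isMaxElt hEr.1.2.2.1).trans hmaxQ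
  have hFp := (hx.eq_of_isMaxElt hFr.1.2.2.1).trans hmaxQ
  have hEl := hEr.1.2.2.2
  have hFl := hFr.1.2.2.2
  rw [hEp] at hEl
  rw [hFp] at hFl
  obtain ⟨t1, t2⟩ := expr_trim a2.left_subset a2.right_subset a1.left_subset a1.right_subset
  obtain ⟨t3, t4⟩ := expr_trim a4.left_subset a4.right_subset a3.left_subset a3.right_subset
  obtain ⟨⟨w1, w2⟩, r1, r2, r3, m1, m2⟩ := mountain_moves (p := DoubleCoset.doubleCoset x
    (parabolic I) (parabolic J)) ⟨_, rfl⟩ (hmaxQ ▸ hx.isMaxElt) a2.notMem_left a4.notMem_left hac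
    hb.1 hd.1 hbd a2.insert_left.symm a4.insert_left.symm rfl rfl hQ2 hQ
  have wE : walk I [add a, sub b, add c, sub d] = [I, insert b K, K, insert d J, J] := by
    rw [a2.walk_eq, a1.walk_eq, walk]
  have wF : walk I [add c, sub d, add a, sub b] = [I, insert d K', K', insert b J, J] := by
    rw [a4.walk_eq, a3.walk_eq, walk]
  -- For distant indices the core is the identity coset on `K`. Block `i` goes to `i + 1`, which
  -- differs from both blocks `j` and `j + 1` beside the cut `c`.
  have s1 := switchback_trivial (Q := Q) (s := c) (t := b) (hQ2 ▸ Finset.mem_insert_self _ _)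
    (Finset.mem_insert_self _ _)
    (simple_ne_conj_longest hx hmaxQ a4.cut_left hb (by rw [hπ1]; omega)) hcb a1.notMem_left
    a2.cut.1 e1 (e2.trans a1.insert_left.symm) (by rw [e1, e2, ← t1, hEp])
    (by rw [e1, e2, ← t2, hEl])
  have s2 := switchback_trivial (Q := Q) (s := a) (t := d) (hQ4 ▸ Finset.mem_insert_self _ _)
    (hQ3 ▸ Finset.mem_insert_self _ _)
    (simple_ne_conj_longest hx hmaxQ a2.cut_left hd (by rw [hπ3]; omega)) had a3.notMem_left
    a4.cut.1 e3 (e4.trans a3.insert_left.symm) (by rw [e3, e4, ← t3, hFp])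
    (by rw [e3, e4, ← t4, hFl])
  refine ⟨I, _, a, b, c, d, hx.isCore, wE ▸ hE, wF ▸ hF, wE ▸ hEr, r1, r2, r3, wF ▸ hFr,
    ?_, m1, m2, ?_⟩
  · rw [w1, wE]
    have := inContext_switchback (I := I) (J := J) e1 e2 s1
    rwa [e2] at this
  · rw [w2, wF]
    have := inContext_switchback (I := I) (J := J) e3 e4 s2
    rwa [e4] at this

end AtomicCoset

theorem mainTheorem5 (n : ℕ) :
    (∀ (I J : Finset (Fin n)) (p : Set (Equiv.Perm (Fin (n + 1)))), IsCore I J p →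
      ∀ E F : List (Finset (Fin n)), IsAtomicReducedExpr I J p E → IsAtomicReducedExpr I J p F →
        Relation.ReflTransGen (AtomicMove I J p) E F) ∧
    (∀ (J : Finset (Fin n)) (i : ℕ), 1 ≤ i → i + 1 ≤ Jᶜ.card →
      ∃ (I : Finset (Fin n)) (p : Set (Equiv.Perm (Fin (n + 1)))) (a b c d e f : Fin n),
        IsCore I J p ∧
        IsAtomWord J [i, i + 1, i] (walk I [add a, sub b, add c, sub d, add b, sub e]) ∧
        IsAtomWord J [i + 1, i, i + 1] (walk I [add c, sub f, add a, sub e, add f, sub d]) ∧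
        IsAtomicReducedExpr I J p (walk I [add a, sub b, add c, sub d, add b, sub e]) ∧
        IsReducedExpr I J p (walk I [add a, add c, sub d, sub e]) ∧
        IsReducedExpr I J p (walk I [add c, add a, sub d, sub e]) ∧
        IsReducedExpr I J p (walk I [add c, add a, sub e, sub d]) ∧
        IsAtomicReducedExpr I J p (walk I [add c, sub f, add a, sub e, add f, sub d]) ∧
        InContext Switchback (walk I [add a, add c, sub d, sub e])
          (walk I [add a, sub b, add c, sub d, add b, sub e]) ∧
        InContext UpUp (walk I [add a, add c, sub d, sub e])
          (walk I [add c, add a, sub d, sub e]) ∧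
        InContext DownDown (walk I [add c, add a, sub d, sub e])
          (walk I [add c, add a, sub e, sub d]) ∧
        InContext Switchback (walk I [add c, add a, sub e, sub d])
          (walk I [add c, sub f, add a, sub e, add f, sub d])) ∧
    (∀ (J : Finset (Fin n)) (i j : ℕ), 1 ≤ i → i ≤ Jᶜ.card → 1 ≤ j → j ≤ Jᶜ.card →
      (i + 1 < j ∨ j + 1 < i) →
      ∃ (I : Finset (Fin n)) (p : Set (Equiv.Perm (Fin (n + 1)))) (a b c d : Fin n),
        IsCore I J p ∧
        IsAtomWord J [i, j] (walk I [add a, sub b, add c, sub d]) ∧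
        IsAtomWord J [j, i] (walk I [add c, sub d, add a, sub b]) ∧
        IsAtomicReducedExpr I J p (walk I [add a, sub b, add c, sub d]) ∧
        IsReducedExpr I J p (walk I [add a, add c, sub b, sub d]) ∧
        IsReducedExpr I J p (walk I [add c, add a, sub b, sub d]) ∧
        IsReducedExpr I J p (walk I [add c, add a, sub d, sub b]) ∧
        IsAtomicReducedExpr I J p (walk I [add c, sub d, add a, sub b]) ∧
        InContext Switchback (walk I [add a, add c, sub b, sub d])
          (walk I [add a, sub b, add c, sub d]) ∧
        InContext UpUp (walk I [add a, add c, sub b, sub d])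
          (walk I [add c, add a, sub b, sub d]) ∧
        InContext DownDown (walk I [add c, add a, sub b, sub d])
          (walk I [add c, add a, sub d, sub b]) ∧
        InContext Switchback (walk I [add c, add a, sub d, sub b])
          (walk I [add c, sub d, add a, sub b])) :=
  ⟨fun _ _ _ _ _ _ hE hF => reflTransGen_atomicMove hE hF,
    fun J i hi hi' => atomic_braid_eq_coset_braid J i hi hi',
    fun J i j hi hi' hj hj' hij => atomic_comm_eq_coset_braid J i j hi hi' hj hj' hij⟩
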